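/- Let $\alpha,\beta\in\mathbb{C}$ with $\operatorname{Re}\alpha\ge 0$, $\alpha\neq 0$, $\operatorname{Re}\beta>0$, and $m=\lfloor\operatorname{Re}\alpha\rfloor+1$. Let $\varphi\in C^m[0,\infty)$ with $\varphi(0)=0$, $\varphi'>0$ on $(0,\infty)$ and $\varphi(x)\to\infty$ as $x\to\infty$; write $D_\varphi=\frac{1}{\varphi'(x)}\frac{d}{dx}$. Let $(a_n)_{n\ge0}$ be complex numbers (the Taylor coefficients of the kernel $\mathcal A$) such that $\mathcal A_\Gamma(x)=\sum_n a_n\Gamma(\beta n+\alpha)x^n$ has positive radius of convergence, and let $\overline{\mathcal A}(x)=\sum_n\overline a_nx^n$ be such that $\overline{\mathcal A}_\Gamma(x)=\sum_n\overline a_n\Gamma(\beta n+m-\alpha)x^n$ satisfies $\mathcal A_\Gamma\cdot\overline{\mathcal A}_\Gamma=1$. For $u:(0,\infty)\to\mathbb{C}$ and $x>0$ put $$I^{\mu}_\varphi u(x)=\frac1{\Gamma(\mu)}\int_0^x\varphi'(t)\,[\varphi(x)-\varphi(t)]^{\mu-1}u(t)\,dt\quad(\operatorname{Re}\mu>0),$$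 $$D^{\gamma}_\varphi u=D_\varphi^{\,k}\, I_\varphi^{k-\gamma}u,\quad k=\lfloor\operatorname{Re}\gamma\rfloor+1\quad(\operatorname{Re}\gamma\ge0),\qquad I^{\mu}_\varphi u=D^{-\mu}_\varphi u\quad(\operatorname{Re}\mu\le0),$$ $$D^{\alpha,\beta}u(x)=D_\varphi^{\,m}\int_0^x\varphi'(t)\,[\varphi(x)-\varphi(t)]^{m-\alpha-1}\,\overline{\mathcal A}\big([\varphi(x)-\varphi(t)]^{\beta}\big)u(t)\,dt,$$ $$\hat f(s)=\int_0^\infty e^{-s\varphi(x)}\varphi'(x)f(x)\,dx.$$ A function $f$ is of $\varphi$-exponential order if $|f(x)|\le Me^{c\varphi(x)}$ for all $x>X$, for some constants $c,M,X>0$. The value $f(0)$ of a function $f$ on $(0,\infty)$ means $\lim_{x\to0^+}f(x)$. Put $N_n=\lfloor\operatorname{Re}(\alpha-\beta n)\rfloor$ for those $n\geq 0$ with $\operatorname{Re}(\alpha-\beta n)\ge0$, i.e. $n\le\lfloor\operatorname{Re}\alpha/\operatorname{Re}\beta\rfloor$. Assume that $\varphi' u$ is integrable on $(0,T]$ for all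 $T>0$; that $u$ and all of $I^{m-\alpha}_\varphi u,\ D_\varphi I^{m-\alpha}_\varphi u,\dots,D_\varphi^{\,m}I^{m-\alpha}_\varphi u$ (exist and) are continuous on $(0,\infty)$ and of $\varphi$-exponential order; that $D^\alpha_\varphi u$ is piecewise continuous on $[0,\infty)$ (so that it has a finite limit at $0^+$); and that, for each $n$ with $1\le n\le\lfloor\operatorname{Re}\alpha/\operatorname{Re}\beta\rfloor$ and $\overline a_n\ne0$, the initial values $\big(I_\varphi^{N_n-i+\beta n-\alpha+1}u\big)(0)$, $0\le i\le N_n$, exist as finite limits. Then $D^{\alpha,\beta}u$ exists on $(0,\infty)$. There is a real $\sigma$ such that for every $s$ with $\operatorname{Re}s>\sigma$ the integrals $\hat u(s)$ and $\widehat{D^{\alpha,\beta}u}(s)$ and the series $\sum_n\overline a_n\Gamma(\beta n-\alpha+m)s^{\alpha-\beta n}$ converge absolutely. At every $s$ with $\operatorname{Re}s>0$ at which these two integrals and this series converge absolutely, $$\widehat{D^{\alpha,\beta}u}(s)=\sum_{n=0}^{\infty}\overline a_n\Gamma(\beta n-\alpha+m)s^{\alpha-\beta n}\hat u(s)-\sum_{n=0}^{\lfloor\operatorname{Re}\alpha/\operatorname{Re}\beta\rfloor}\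 \sum_{i=0}^{N_n}\overline a_n\Gamma(\beta n-\alpha+m)\,s^{N_n-i}\big(I_\varphi^{N_n-i+\beta n-\alpha+1}u\big)(0),$$ where $s^{\alpha-\beta n}$ is the principal power and a term with $n\geq 1$ and $\overline a_n=0$ is read as $0$. -/

import Mathlib

open Set Filter Topology MeasureTheory

noncomputable section

/-- The operator `(1 / φ'(x)) d/dx`. -/
def phiDeriv (φ : ℝ → ℝ) (f : ℝ → ℂ) (x : ℝ) : ℂ :=
  ((deriv φ x : ℝ) : ℂ)⁻¹ * deriv f x

/-- The Riemann-Liouville fractional integral (base point `0`) of order `μ`, `0 < Re μ`,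
with respect to `φ`. -/
def rlIntegral (φ : ℝ → ℝ) (μ : ℂ) (u : ℝ → ℂ) (x : ℝ) : ℂ :=
  (Complex.Gamma μ)⁻¹ *
    ∫ t in (0 : ℝ)..x, ((deriv φ t : ℝ) : ℂ) * ((φ x - φ t : ℝ) : ℂ) ^ (μ - 1) * u t

/-- The Riemann-Liouville fractional derivative of order `γ`, `0 ≤ Re γ`, with respect to `φ`:
`n` applications of `(1 / φ') d/dx` to the integral of order `n - γ`, with `n = ⌊Re γ⌋ + 1`. -/
def rlDerivative (φ : ℝ → ℝ) (γ : ℂ) (u : ℝ → ℂ) : ℝ → ℂ :=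
  (phiDeriv φ)^[⌊γ.re⌋₊ + 1] (rlIntegral φ (((⌊γ.re⌋₊ + 1 : ℕ) : ℂ) - γ) u)

/-- The fractional integral of arbitrary complex order, under the usual convention that an integral
of order `μ` with `Re μ ≤ 0` is the Riemann-Liouville derivative of order `-μ`. -/
def rlDifferintegral (φ : ℝ → ℝ) (μ : ℂ) (u : ℝ → ℂ) : ℝ → ℂ :=
  if 0 < μ.re then rlIntegral φ μ u else rlDerivative φ (-μ) u

/-- The function `x ↦ ∑ aₙ xⁿ`. -/
def kernelFun (a : ℕ → ℂ) (z : ℂ) : ℂ := ∑' n, a n * z ^ n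

/-- The coefficients `aₙ Γ(β n + μ)` of the transformed series `A_Γ` belonging to the
order `μ` and the parameter `β`. -/
def gammaCoeff (a : ℕ → ℂ) (μ β : ℂ) (n : ℕ) : ℂ := a n * Complex.Gamma (β * n + μ)

/-- The power series with coefficients `c` has positive radius of convergence. -/
def HasPosRadius (c : ℕ → ℂ) : Prop := ∃ r : ℝ, 0 < r ∧ Summable fun n => ‖c n‖ * r ^ n

/-- The generalised fractional integral (base point `0`) of order `(μ, β)` with respect to `φ`,
whose kernel is the function with power series coefficients `a`. -/
def genIntegral (φ : ℝ → ℝ) (a : ℕ → ℂ) (μ β : ℂ) (u : ℝ → ℂ) (x : ℝ) : ℂ :=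
  ∫ t in (0 : ℝ)..x, ((deriv φ t : ℝ) : ℂ) * ((φ x - φ t : ℝ) : ℂ) ^ (μ - 1) *
    kernelFun a (((φ x - φ t : ℝ) : ℂ) ^ β) * u t

/-- The generalised fractional derivative of Riemann-Liouville type of order `(α, β)` with respect
to `φ`; here `abar` are the coefficients of the conjugate kernel. -/
def genDerivative (φ : ℝ → ℝ) (abar : ℕ → ℂ) (α β : ℂ) (u : ℝ → ℂ) : ℝ → ℂ :=
  (phiDeriv φ)^[⌊α.re⌋₊ + 1] (genIntegral φ abar (((⌊α.re⌋₊ + 1 : ℕ) : ℂ) - α) β u)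

/-- The integrand of the generalised Laplace transform. -/
def phiLaplaceIntegrand (φ : ℝ → ℝ) (f : ℝ → ℂ) (s : ℂ) (x : ℝ) : ℂ :=
  Complex.exp (-s * (φ x : ℂ)) * ((deriv φ x : ℝ) : ℂ) * f x

/-- The integral defining the generalised Laplace transform of `f` at `s` converges. -/
def PhiLaplaceConvergent (φ : ℝ → ℝ) (f : ℝ → ℂ) (s : ℂ) : Prop :=
  IntegrableOn (phiLaplaceIntegrand φ f s) (Ioi 0)

/-- The generalised Laplace transform of `f` with respect to `φ`. -/
def phiLaplace (φ : ℝ → ℝ) (f : ℝ → ℂ) (s : ℂ) : ℂ :=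
  ∫ x in Ioi (0 : ℝ), phiLaplaceIntegrand φ f s x

/-- `f` is of `φ`-exponential order. -/
def PhiExpOrder (φ : ℝ → ℝ) (f : ℝ → ℂ) : Prop :=
  ∃ c M X : ℝ, 0 < c ∧ 0 < M ∧ 0 < X ∧ ∀ x, X < x → ‖f x‖ ≤ M * Real.exp (c * φ x)

/-- Piecewise continuity on `[0, ∞)`: in every `[0, T]` there are only finitely many
discontinuities, and all one-sided limits exist. (The value at an exceptional point is
irrelevant, in particular at `0`.) -/
def PiecewiseContinuousIci (f : ℝ → ℂ) : Prop :=
  (∀ T : ℝ, 0 < T → ∃ S : Finset ℝ, ∀ x ∈ Icc 0 T, x ∉ S → ContinuousWithinAt f (Ici 0) x) ∧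
  ∀ x : ℝ, 0 ≤ x → (∃ L : ℂ, Tendsto f (𝓝[>] x) (𝓝 L)) ∧
    (0 < x → ∃ L : ℂ, Tendsto f (𝓝[<] x) (𝓝 L))

/-- The function `f` on `(0, ∞)` has a (finite) value at `0`, as a limit from the right. -/
def HasValueAtZero (f : ℝ → ℂ) : Prop := ∃ L : ℂ, Tendsto f (𝓝[>] 0) (𝓝 L)

/-- The value at `0` of a function on `(0, ∞)`, as a limit from the right. -/
def valueAtZero (f : ℝ → ℂ) : ℂ := limUnder (𝓝[>] (0 : ℝ)) f

/-- `Nₙ = ⌊Re (α - β n)⌋`, used only when `0 ≤ Re (α - β n)`. -/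
def initOrder (α β : ℂ) (n : ℕ) : ℕ := ⌊(α - β * n).re⌋₊

/-- The fractional integral of `u` of order `Nₙ - i + β n - α + 1`, whose value at `0` is the
`(n, i)`-th initial value. -/
def initFun (φ : ℝ → ℝ) (α β : ℂ) (u : ℝ → ℂ) (n i : ℕ) : ℝ → ℂ :=
  rlDifferintegral φ ((initOrder α β n : ℂ) - i + β * n - α + 1) u

end

/-! The substitution `y = φ x` turns `φ' dt` into `dy`, `D_φ` into `d/dy`, the transform into the
ordinary Laplace transform, and `I^μ u` into the convolution of `rlKernel μ` with `v = u ∘ φ⁻¹`. Put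
`μ = m - α` and `bₙ = ā_n Γ(βn + μ)`. The kernel of `D^{α,β}` becomes `∑ bₙ rlKernel (βn + μ)`, and
`bₙ` grows at most geometrically because it is the coefficient sequence of the reciprocal of a
convergent power series (`GeomBdd.of_mul_eq_one`).

Cut the series after `n₀ = ⌊Re α / Re β⌋`. The tail is the `m`-fold primitive of a series kernel of
order `q = β(n₀+1) - α`, and `Re q > 0`; its `m` derivatives therefore leave a plain convolution and
no initial values (`cconv_kernelFun_eq`). Each of the finitely many head terms obeys the classical
rule for the transform of an `m`-th derivative, and only its last `Nₙ + 1` initial values survive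
(`DerivChain.lap_eq_of_cconv`).

The delicate point is that for `n ≥ 1` the `m`-th derivative of a head term must be integrable at
`0`. Convolving the Taylor expansion of `I^μ u` with `rlKernel (βn)` exhibits the possible
singularities as finitely many powers. A finite limit of the derivative of order `m - 1` eliminates
the bad ones, since a sum of distinct powers has a limit at `0` only if each nonconstant power of
nonpositive real exponent has coefficient `0` (`powers_of_tendsto`, `fracChain_last`).

This proves the identity for large `Re s`. At any other admissible `s₀` it is carried inward along
the ray `eˣ s₀`, `x ≥ 0`, on which all three objects still converge (`lap_eq_of_eventually`). -/

noncomputable section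

/-! ### Causal convolution -/

/-- Functions continuous on `(0, ∞)` and integrable near `0`. -/
def CausalReg {𝕜 : Type*} [RCLike 𝕜] (f : ℝ → 𝕜) : Prop :=
  ContinuousOn f (Ioi 0) ∧ ∀ T : ℝ, IntegrableOn f (Ioc 0 T)

/-- The convolution of two functions on `(0, ∞)`. -/
def cconv {𝕜 : Type*} [RCLike 𝕜] (f g : ℝ → 𝕜) (y : ℝ) : 𝕜 :=
  ∫ t in (0 : ℝ)..y, f (y - t) * g t

section Convolution

variable {𝕜 : Type*} [RCLike 𝕜] {f g k : ℝ → 𝕜}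

lemma cconv_comm (f g : ℝ → 𝕜) : cconv f g = cconv g f := by
  ext y
  have := intervalIntegral.integral_comp_sub_left (a := 0) (b := y)
    (fun t => f (y - t) * g t) y
  simp only [sub_sub_cancel, sub_zero, sub_self] at this
  rw [cconv, ← this, cconv]
  simp_rw [mul_comm]

lemma CausalReg.intervalIntegrable (hf : CausalReg f) {y : ℝ} (hy : 0 ≤ y) :
    IntervalIntegrable f volume 0 y :=
  (intervalIntegrable_iff_integrableOn_Ioc_of_le hy).2 (hf.2 y)

/-- The two possible singularities sit at opposite ends. On each half of `[0, y]` one factor is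
integrable and the other continuous on a compact set. -/
lemma CausalReg.intervalIntegrable_cconv (hf : CausalReg f) (hg : CausalReg g) {y : ℝ}
    (hy : 0 < y) : IntervalIntegrable (fun t => f (y - t) * g t) volume 0 y := by
  have key : ∀ {f g : ℝ → 𝕜}, CausalReg f → CausalReg g →
      IntervalIntegrable (fun t => f (y - t) * g t) volume 0 (y / 2) := by
    intro f g hf hg
    refine (hg.intervalIntegrable (by positivity)).continuousOn_mul ?_
    refine hf.1.comp (by fun_prop) ?_
    intro t ht
    rw [uIcc_of_le (by positivity)] at ht
    simp only [mem_Ioi]; linarith [ht.2]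
  refine (key hf hg).trans ?_
  have h := (key hg hf).comp_sub_left y
  simp only [sub_sub_cancel, sub_zero] at h
  have h2 : y - y / 2 = y / 2 := by ring
  rw [h2] at h
  simpa [mul_comm] using h.symm

lemma CausalReg.norm (hf : CausalReg f) : CausalReg fun y => ‖f y‖ :=
  ⟨hf.1.norm, fun T => (hf.2 T).norm⟩

lemma CausalReg.add (hf : CausalReg f) (hg : CausalReg g) : CausalReg fun y => f y + g y :=
  ⟨hf.1.add hg.1, fun T => (hf.2 T).add (hg.2 T)⟩

lemma CausalReg.const_mul (hf : CausalReg f) (c : 𝕜) : CausalReg fun y => c * f y :=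
  ⟨continuousOn_const.mul hf.1, fun T => (hf.2 T).const_mul c⟩

lemma CausalReg.sum {ι : Type*} {s : Finset ι} {F : ι → ℝ → 𝕜} (h : ∀ i ∈ s, CausalReg (F i)) :
    CausalReg fun y => ∑ i ∈ s, F i y :=
  ⟨continuousOn_finsetSum s fun i hi => (h i hi).1,
    fun T => integrable_finsetSum s fun i hi => (h i hi).2 T⟩

lemma CausalReg.congr (hf : CausalReg f) (h : ∀ y, 0 < y → g y = f y) : CausalReg g :=
  ⟨hf.1.congr fun y hy => h y hy, fun T => (hf.2 T).congr_fun
    (fun y hy => (h y hy.1).symm) measurableSet_Ioc⟩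

lemma cconv_congr {f' g' : ℝ → 𝕜} (hf : ∀ y, 0 < y → f y = f' y)
    (hg : ∀ y, 0 < y → g y = g' y) {y : ℝ} (hy : 0 < y) : cconv f g y = cconv f' g' y := by
  simp only [cconv, intervalIntegral.integral_of_le hy.le, integral_Ioc_eq_integral_Ioo]
  refine setIntegral_congr_fun measurableSet_Ioo fun t ht => ?_
  rw [hf _ (by linarith [ht.2]), hg _ ht.1]

lemma cconv_eq_convolution {y : ℝ} (hy : 0 < y) : cconv f g y =
    MeasureTheory.convolution (indicator (Ioi 0) f) (indicator (Ioi 0) g)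
      (ContinuousLinearMap.mul ℝ 𝕜) volume y := by
  rw [← posConvolution_eq_convolution_indicator f g _ volume, posConvolution,
    indicator_of_mem (mem_Ioi.2 hy), cconv_comm, cconv]
  simp [mul_comm]

lemma convolution_indicator_of_nonpos {y : ℝ} (hy : y ≤ 0) :
    MeasureTheory.convolution (indicator (Ioi 0) f) (indicator (Ioi 0) g)
      (ContinuousLinearMap.mul ℝ 𝕜) volume y = 0 := by
  rw [← posConvolution_eq_convolution_indicator f g _ volume, posConvolution,
    indicator_of_notMem (by simpa using hy)]

lemma CausalReg.convolutionExistsAt (hf : CausalReg f) (hg : CausalReg g) (y : ℝ) :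
    ConvolutionExistsAt (indicator (Ioi 0) f) (indicator (Ioi 0) g) y
      (ContinuousLinearMap.mul ℝ 𝕜) volume := by
  have h : (fun t => (ContinuousLinearMap.mul ℝ 𝕜) (indicator (Ioi 0) f t)
      (indicator (Ioi 0) g (y - t))) = indicator (Ioo 0 y) fun t => f t * g (y - t) := by
    ext t
    by_cases h1 : 0 < t <;> by_cases h2 : t < y <;> simp [h1, h2, indicator]
  rw [ConvolutionExistsAt, h, integrable_indicator_iff measurableSet_Ioo]
  rcases le_or_gt y 0 with hy | hy
  · simp [Ioo_eq_empty_of_le hy]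
  · have := hg.intervalIntegrable_cconv hf hy
    rw [intervalIntegrable_iff_integrableOn_Ioo_of_le hy.le] at this
    simpa [mul_comm] using this

/-- For `t < y/2` the argument `y - t` stays away from `0`, so `C ‖g‖` dominates. The moving
endpoint is absorbed into an indicator, discontinuous in `y` at `y₀` only for the single value `t =
y₀/2`. -/
lemma continuousAt_cconv_half (hf : CausalReg f) (hg : CausalReg g) {y₀ : ℝ} (hy₀ : 0 < y₀) :
    ContinuousAt (fun y => ∫ t in (0 : ℝ)..y / 2, f (y - t) * g t) y₀ := by
  have hev : ∀ᶠ y in 𝓝 y₀, y ∈ Ioo (2 * y₀ / 3) (4 * y₀ / 3) :=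
    Ioo_mem_nhds (by linarith) (by linarith)
  have hEq : (fun y => ∫ t in Ioo 0 y₀, (Iio (y / 2)).indicator (fun t => f (y - t) * g t) t)
      =ᶠ[𝓝 y₀] (fun y => ∫ t in (0 : ℝ)..y / 2, f (y - t) * g t) := by
    filter_upwards [hev] with y hy
    rw [intervalIntegral.integral_of_le (by linarith [hy.1]), integral_Ioc_eq_integral_Ioo,
      setIntegral_indicator measurableSet_Iio]
    congr 2
    ext t
    simp only [mem_inter_iff, mem_Iio, mem_Ioo]
    constructor
    · rintro ⟨⟨a, b⟩, c⟩; exact ⟨a, c⟩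
    · rintro ⟨a, c⟩; exact ⟨⟨a, by linarith [hy.2]⟩, c⟩
  refine ContinuousAt.congr ?_ hEq
  obtain ⟨C, hC⟩ := (isCompact_Icc (a := y₀ / 3) (b := 4 * y₀ / 3)).exists_bound_of_continuousOn
    (hf.1.mono fun t ht => by simp only [mem_Ioi]; linarith [ht.1])
  refine continuousAt_of_dominated (bound := fun t => C * ‖g t‖) ?_ ?_
    (((hg.2 y₀).mono_set Ioo_subset_Ioc_self).norm.const_mul C) ?_
  · filter_upwards [hev] with y hy
    rw [aestronglyMeasurable_indicator_iff measurableSet_Iio,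
      Measure.restrict_restrict measurableSet_Iio]
    refine ContinuousOn.aestronglyMeasurable ?_ (measurableSet_Iio.inter measurableSet_Ioo)
    refine (hf.1.comp (by fun_prop) fun t ht => ?_).mul (hg.1.mono fun t ht => ht.2.1)
    have h1 : t < y / 2 := ht.1
    simp only [mem_Ioi]; linarith [hy.1]
  · filter_upwards [hev] with y hy
    rw [ae_restrict_iff' measurableSet_Ioo]
    refine Eventually.of_forall fun t ht => ?_
    by_cases h : t < y / 2
    · rw [indicator_of_mem (by exact h), norm_mul]
      gcongr
      exact hC _ ⟨by linarith [hy.1], by linarith [hy.2, ht.1]⟩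
    · rw [indicator_of_notMem (by exact h), norm_zero]
      have : 0 ≤ C := (norm_nonneg _).trans (hC y₀ ⟨by linarith, by linarith⟩)
      positivity
  · rw [ae_restrict_iff' measurableSet_Ioo]
    have : ∀ᵐ t : ℝ, t ≠ y₀ / 2 := by simp [ae_iff, measure_singleton]
    filter_upwards [this] with t ht ht2
    rcases lt_or_gt_of_ne ht with h | h
    · have h1 : (fun y => f (y - t) * g t) =ᶠ[𝓝 y₀]
          (fun y => (Iio (y / 2)).indicator (fun t => f (y - t) * g t) t) := by
        have : ∀ᶠ y in 𝓝 y₀, 2 * t < y := lt_mem_nhds (by linarith)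
        filter_upwards [this] with y hy
        rw [indicator_of_mem (by simp only [mem_Iio]; linarith)]
      refine ContinuousAt.congr ?_ h1
      have h3 : ContinuousAt f (y₀ - t) := hf.1.continuousAt (Ioi_mem_nhds (by linarith))
      refine ContinuousAt.mul ?_ continuousAt_const
      exact ContinuousAt.comp (f := fun y => y - t) h3 (by fun_prop)
    · have h1 : (fun y => (0 : 𝕜)) =ᶠ[𝓝 y₀]
          (fun y => (Iio (y / 2)).indicator (fun t => f (y - t) * g t) t) := by
        have : ∀ᶠ y in 𝓝 y₀, y < 2 * t := gt_mem_nhds (by linarith)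
        filter_upwards [this] with y hy
        rw [indicator_of_notMem (by simp only [mem_Iio]; linarith)]
      exact continuousAt_const.congr h1

lemma CausalReg.cconv (hf : CausalReg f) (hg : CausalReg g) : CausalReg (cconv f g) := by
  constructor
  · intro y₀ hy₀
    refine ContinuousAt.continuousWithinAt ?_
    have hEq : (fun y => (∫ t in (0 : ℝ)..y / 2, f (y - t) * g t) +
        ∫ t in (0 : ℝ)..y / 2, g (y - t) * f t) =ᶠ[𝓝 y₀] _root_.cconv f g := by
      filter_upwards [Ioi_mem_nhds hy₀] with y hy
      have hy : 0 < y := hy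
      have h1 := hf.intervalIntegrable_cconv hg hy
      have h2 := intervalIntegral.integral_comp_sub_left (a := 0) (b := y / 2)
        (fun t => f (y - t) * g t) y
      have h3 : y - y / 2 = y / 2 := by ring
      simp only [sub_sub_cancel, sub_zero, h3] at h2
      simp_rw [mul_comm (g _)]
      rw [h2, _root_.cconv]
      refine intervalIntegral.integral_add_adjacent_intervals (h1.mono_set ?_) (h1.mono_set ?_) <;>
      · rw [uIcc_of_le (by linarith), uIcc_of_le (by linarith)]
        exact Icc_subset_Icc (by linarith) (by linarith)
    exact ContinuousAt.congr ((continuousAt_cconv_half hf hg hy₀).add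
      (continuousAt_cconv_half hg hf hy₀)) hEq
  · intro T
    -- Up to `T` the convolution sees only the truncations at `T`, which are integrable on the whole
    -- half-line.
    have key : ∀ {f : ℝ → 𝕜}, CausalReg f → IntegrableOn (indicator (Iic T) f) (Ioi 0) := by
      intro f hf
      rw [integrableOn_indicator_iff measurableSet_Iic]
      exact (hf.2 T).mono_set fun t ht => ⟨ht.2, ht.1⟩
    have h := integrable_posConvolution (key hf) (key hg) (ContinuousLinearMap.mul ℝ 𝕜)
    refine (h.integrableOn (s := Ioc 0 T)).congr_fun (fun y hy => ?_) measurableSet_Ioc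
    rw [posConvolution, indicator_of_mem (mem_Ioi.2 hy.1), cconv_comm, _root_.cconv]
    refine intervalIntegral.integral_congr fun t ht => ?_
    rw [uIcc_of_le hy.1.le] at ht
    simp only [ContinuousLinearMap.mul_apply']
    rw [indicator_of_mem (mem_Iic.2 (ht.2.trans hy.2)), indicator_of_mem, mul_comm]
    simp only [mem_Iic]; linarith [ht.1, hy.2]

lemma indicator_cconv (f g : ℝ → 𝕜) :
    indicator (Ioi 0) (cconv f g) = MeasureTheory.convolution (indicator (Ioi 0) f)
      (indicator (Ioi 0) g) (ContinuousLinearMap.mul ℝ 𝕜) volume := by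
  ext t
  by_cases ht : 0 < t
  · rw [indicator_of_mem (mem_Ioi.2 ht), cconv_eq_convolution ht]
  · rw [indicator_of_notMem (by simpa using ht), convolution_indicator_of_nonpos (not_lt.1 ht)]

lemma cconv_assoc (hf : CausalReg f) (hg : CausalReg g) (hk : CausalReg k) {y : ℝ} (hy : 0 < y) :
    cconv (cconv f g) k y = cconv f (cconv g k) y := by
  have meas : ∀ {f : ℝ → 𝕜}, CausalReg f → AEStronglyMeasurable (indicator (Ioi 0) f) volume :=
    fun hf => (aestronglyMeasurable_indicator_iff measurableSet_Ioi).2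
      (hf.1.aestronglyMeasurable measurableSet_Ioi)
  have hn : ∀ f : ℝ → 𝕜, (fun x => ‖indicator (Ioi 0) f x‖) = indicator (Ioi 0) fun x => ‖f x‖ :=
    fun f => by ext x; by_cases hx : 0 < x <;> simp [indicator, hx]
  rw [cconv_eq_convolution hy, cconv_eq_convolution hy, indicator_cconv,
    indicator_cconv]
  refine convolution_assoc _ _ _ _ (fun x y z => by simp [mul_assoc]) (meas hf) (meas hg) (meas hk)
    (Eventually.of_forall fun x => hf.convolutionExistsAt hg x) ?_ ?_
  · refine Eventually.of_forall fun x => ?_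
    rw [hn, hn]
    exact hg.norm.convolutionExistsAt hk.norm x
  · rw [hn, hn, hn, ← indicator_cconv]
    exact hf.norm.convolutionExistsAt (hg.norm.cconv hk.norm) y

lemma cconv_add_left {f₁ f₂ : ℝ → 𝕜} (h₁ : CausalReg f₁) (h₂ : CausalReg f₂) (hg : CausalReg g)
    {y : ℝ} (hy : 0 < y) :
    cconv (fun t => f₁ t + f₂ t) g y = cconv f₁ g y + cconv f₂ g y := by
  simp only [cconv, add_mul]
  exact intervalIntegral.integral_add (h₁.intervalIntegrable_cconv hg hy)
    (h₂.intervalIntegrable_cconv hg hy)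

lemma cconv_const_mul_left (c : 𝕜) (f g : ℝ → 𝕜) (y : ℝ) :
    cconv (fun t => c * f t) g y = c * cconv f g y := by
  simp only [cconv, mul_assoc, intervalIntegral.integral_const_mul]

lemma cconv_sum_left {ι : Type*} {s : Finset ι} {F : ι → ℝ → 𝕜} (h : ∀ i ∈ s, CausalReg (F i))
    (hg : CausalReg g) {y : ℝ} (hy : 0 < y) :
    cconv (fun t => ∑ i ∈ s, F i t) g y = ∑ i ∈ s, cconv (F i) g y := by
  simp only [cconv, Finset.sum_mul]
  exact intervalIntegral.integral_finsetSum fun i hi => (h i hi).intervalIntegrable_cconv hg hy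

lemma norm_cconv_le {y : ℝ} (hy : 0 < y) :
    ‖cconv f g y‖ ≤ cconv (fun t => ‖f t‖) (fun t => ‖g t‖) y := by
  simp only [cconv, ← norm_mul]
  exact intervalIntegral.norm_integral_le_integral_norm hy.le

end Convolution

/-! ### Laplace transforms -/

/-- Absolute convergence of the Laplace integral of `f` at `s`. -/
def LapConv (f : ℝ → ℂ) (s : ℂ) : Prop :=
  IntegrableOn (fun y : ℝ => Complex.exp (-s * y) * f y) (Ioi 0)

/-- The Laplace transform. -/
def lap (f : ℝ → ℂ) (s : ℂ) : ℂ := ∫ y in Ioi (0 : ℝ), Complex.exp (-s * y) * f y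

section Laplace

variable {f g : ℝ → ℂ} {s s' : ℂ}

lemma norm_cexp_neg_mul (s : ℂ) (y : ℝ) :
    ‖Complex.exp (-s * y)‖ = Real.exp (-(s.re * y)) := by
  rw [Complex.norm_exp]; simp

lemma LapConv.mono (h : LapConv f s) (hs : s.re ≤ s'.re) : LapConv f s' := by
  have : (fun y : ℝ => Complex.exp (-s' * y) * f y) =
      fun y : ℝ => Complex.exp (-(s' - s) * y) * (Complex.exp (-s * y) * f y) := by
    ext y; rw [← mul_assoc, ← Complex.exp_add]; ring_nf
  rw [LapConv, this]
  refine Integrable.bdd_mul (c := 1) h (by fun_prop) ?_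
  rw [ae_restrict_iff' measurableSet_Ioi]
  refine Eventually.of_forall fun y hy => ?_
  rw [norm_cexp_neg_mul, Real.exp_le_one_iff, Complex.sub_re]
  have : 0 ≤ (s'.re - s.re) * y := mul_nonneg (by linarith) (le_of_lt hy)
  linarith

lemma LapConv.add (hf : LapConv f s) (hg : LapConv g s) : LapConv (fun y => f y + g y) s := by
  simpa only [LapConv, mul_add] using! Integrable.add hf hg

lemma LapConv.const_mul (hf : LapConv f s) (c : ℂ) : LapConv (fun y => c * f y) s := by
  simpa only [LapConv, mul_left_comm] using! Integrable.const_mul hf c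

lemma LapConv.sum {ι : Type*} {t : Finset ι} {F : ι → ℝ → ℂ} (h : ∀ i ∈ t, LapConv (F i) s) :
    LapConv (fun y => ∑ i ∈ t, F i y) s := by
  simpa only [LapConv, Finset.mul_sum] using! integrable_finsetSum t h

lemma LapConv.congr (hf : LapConv f s) (h : ∀ y, 0 < y → g y = f y) : LapConv g s :=
  IntegrableOn.congr_fun hf (fun y hy => by rw [h y hy]) measurableSet_Ioi

lemma lap_congr (h : ∀ y, 0 < y → g y = f y) : lap g s = lap f s :=
  setIntegral_congr_fun measurableSet_Ioi fun y hy => by rw [h y hy]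

lemma lap_add (hf : LapConv f s) (hg : LapConv g s) :
    lap (fun y => f y + g y) s = lap f s + lap g s := by
  simp only [lap, mul_add]; exact integral_add hf hg

lemma lap_const_mul (c : ℂ) (f : ℝ → ℂ) (s : ℂ) : lap (fun y => c * f y) s = c * lap f s := by
  simp only [lap, mul_left_comm _ c]; exact integral_const_mul c _

lemma lap_sum {ι : Type*} {t : Finset ι} {F : ι → ℝ → ℂ} (h : ∀ i ∈ t, LapConv (F i) s) :
    lap (fun y => ∑ i ∈ t, F i y) s = ∑ i ∈ t, lap (F i) s := by
  simp only [lap, Finset.mul_sum]; exact integral_finsetSum t h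

/-- Since the exponential is multiplicative, its weight distributes over a convolution; the product
rule for `lap` is then Fubini for integrable functions. -/
lemma cexp_mul_cconv (f g : ℝ → ℂ) (s : ℂ) (y : ℝ) :
    Complex.exp (-s * y) * cconv f g y = ∫ t in (0 : ℝ)..y,
      (ContinuousLinearMap.mul ℝ ℂ) (Complex.exp (-s * t) * f t)
        (Complex.exp (-s * (y - t : ℝ)) * g (y - t)) := by
  rw [cconv_comm, cconv, ← intervalIntegral.integral_const_mul]
  congr 1; ext t
  have : Complex.exp (-s * y) = Complex.exp (-s * t) * Complex.exp (-s * (y - t : ℝ)) := by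
    rw [← Complex.exp_add]; push_cast; ring_nf
  rw [this, ContinuousLinearMap.mul_apply']; ring

lemma LapConv.cconv (hf : LapConv f s) (hg : LapConv g s) : LapConv (cconv f g) s := by
  have h := integrable_posConvolution hf hg (ContinuousLinearMap.mul ℝ ℂ)
  refine (h.integrableOn (s := Ioi 0)).congr_fun (fun y hy => ?_) measurableSet_Ioi
  rw [posConvolution, indicator_of_mem hy]
  exact (cexp_mul_cconv f g s y).symm

lemma lap_cconv (hf : LapConv f s) (hg : LapConv g s) :
    lap (cconv f g) s = lap f s * lap g s := by
  have h := integral_posConvolution hf hg (ContinuousLinearMap.mul ℝ ℂ)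
  simp only [lap, cexp_mul_cconv]
  exact h

lemma CausalReg.exists_lapConv (hf : CausalReg f) {M c X : ℝ}
    (h : ∀ y, X < y → ‖f y‖ ≤ M * Real.exp (c * y)) : ∀ s : ℂ, c < s.re → LapConv f s := by
  intro s hs
  set Y := max X 0
  have hY : 0 ≤ Y := le_max_right _ _
  rw [LapConv, ← Ioc_union_Ioi_eq_Ioi hY, integrableOn_union]
  have hcont : Continuous fun y : ℝ => Complex.exp (-s * y) := by fun_prop
  constructor
  · refine ((hf.intervalIntegrable hY).continuousOn_mul hcont.continuousOn).1
  · have hint : IntegrableOn (fun y => M * Real.exp (-(s.re - c) * y)) (Ioi Y) :=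
      (integrableOn_exp_mul_Ioi (by linarith) Y).const_mul M
    refine hint.mono' ?_ ?_
    · exact (hcont.continuousOn.mul (hf.1.mono (Ioi_subset_Ioi hY))).aestronglyMeasurable
        measurableSet_Ioi
    · rw [ae_restrict_iff' measurableSet_Ioi]
      refine Eventually.of_forall fun y hy => ?_
      rw [norm_mul, norm_cexp_neg_mul]
      have h1 := h y ((le_max_left X 0).trans_lt hy)
      calc _ ≤ Real.exp (-(s.re * y)) * (M * Real.exp (c * y)) := by gcongr
        _ = _ := by rw [mul_left_comm, ← Real.exp_add]; ring_nf

lemma differentiableOn_lap (hf : LapConv f s) :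
    DifferentiableOn ℂ (lap f) {z | s.re < z.re} := by
  intro z hz
  have hz : s.re < z.re := hz
  refine DifferentiableAt.differentiableWithinAt ?_
  set ε := (z.re - s.re) / 2 with hε
  have hε0 : 0 < ε := by simp only [hε]; linarith
  have hball : ∀ w ∈ Metric.ball z ε, s.re + ε ≤ w.re := by
    intro w hw
    have h1 := (Complex.abs_re_le_norm (w - z)).trans_lt (mem_ball_iff_norm.1 hw)
    rw [Complex.sub_re, abs_lt] at h1
    linarith [h1.1]
  refine (hasDerivAt_integral_of_dominated_loc_of_deriv_le
    (F := fun w (y : ℝ) => Complex.exp (-w * y) * f y)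
    (F' := fun w (y : ℝ) => (-y : ℂ) * (Complex.exp (-w * y) * f y))
    (bound := fun y : ℝ => ε⁻¹ * ‖Complex.exp (-s * y) * f y‖)
    (Metric.ball_mem_nhds z hε0) ?_ (hf.mono hz.le) ?_ ?_ (hf.norm.const_mul _) ?_).2
      |>.differentiableAt
  · filter_upwards [Metric.ball_mem_nhds z hε0] with w hw
    exact (hf.mono (by linarith [hball w hw])).aestronglyMeasurable
  · refine AEStronglyMeasurable.mul ?_ (hf.mono hz.le).aestronglyMeasurable
    exact (by fun_prop : Continuous fun y : ℝ => (-y : ℂ)).aestronglyMeasurable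
  · rw [ae_restrict_iff' measurableSet_Ioi]
    refine Eventually.of_forall fun y hy w hw => ?_
    have hy : 0 < y := hy
    have h1 := hball w hw
    rw [norm_mul, norm_mul, norm_mul, norm_cexp_neg_mul, norm_cexp_neg_mul, ← mul_assoc,
      ← mul_assoc, norm_neg, Complex.norm_real, Real.norm_eq_abs, abs_of_pos hy]
    refine mul_le_mul_of_nonneg_right ?_ (norm_nonneg _)
    have h2 : Real.exp (-(w.re * y)) ≤ Real.exp (-(ε * y)) * Real.exp (-(s.re * y)) := by
      rw [← Real.exp_add, Real.exp_le_exp]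
      nlinarith
    -- The factor `y` from differentiation is paid for by half of the distance to the boundary of
    -- the half-plane.
    have h3 : y * Real.exp (-(ε * y)) ≤ ε⁻¹ := by
      rw [Real.exp_neg, ← div_eq_mul_inv, div_le_iff₀ (Real.exp_pos _)]
      have := Real.add_one_le_exp (ε * y)
      rw [inv_mul_eq_div, le_div_iff₀ hε0]
      nlinarith
    calc _ ≤ y * (Real.exp (-(ε * y)) * Real.exp (-(s.re * y))) :=
        mul_le_mul_of_nonneg_left h2 hy.le
      _ ≤ _ := by
        rw [← mul_assoc]; exact mul_le_mul_of_nonneg_right h3 (Real.exp_pos _).le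
  · refine Eventually.of_forall fun y w _ => ?_
    have h1 : HasDerivAt (fun w : ℂ => -w * (y : ℂ)) (-1 * (y : ℂ)) w :=
      ((hasDerivAt_id w).neg).mul_const _
    have h2 := (h1.cexp).mul_const (f y)
    convert! h2 using 1; ring

/-- The half-plane is closed here because the final continuation must reach its boundary point. -/
lemma continuousOn_lap (hf : LapConv f s) : ContinuousOn (lap f) {z | s.re ≤ z.re} := by
  refine continuousOn_of_dominated (bound := fun y : ℝ => ‖Complex.exp (-s * y) * f y‖) ?_ ?_
    hf.norm ?_
  · exact fun z hz => (hf.mono hz).aestronglyMeasurable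
  · intro z hz
    rw [ae_restrict_iff' measurableSet_Ioi]
    refine Eventually.of_forall fun y hy => ?_
    rw [norm_mul, norm_mul, norm_cexp_neg_mul, norm_cexp_neg_mul]
    have : s.re * y ≤ z.re * y := mul_le_mul_of_nonneg_right hz (le_of_lt hy)
    gcongr
  · exact Eventually.of_forall fun y => by fun_prop

end Laplace

/-! ### Power kernels -/

/-- The Riemann-Liouville kernel `y ^ (p - 1) / Γ(p)`. -/
def rlKernel (p : ℂ) (y : ℝ) : ℂ := (Complex.Gamma p)⁻¹ * (y : ℂ) ^ (p - 1)

lemma rlKernel_one (y : ℝ) : rlKernel 1 y = 1 := by simp [rlKernel]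

/-- No restriction on `p` is needed: with `Γ = 0` at its poles and `0⁻¹ = 0`, the inverse of `Γ` is
the entire function `1/Γ`, whose functional equation holds everywhere. -/
lemma hasDerivAt_rlKernel (p : ℂ) {y : ℝ} (hy : 0 < y) :
    HasDerivAt (rlKernel p) (rlKernel (p - 1) y) y := by
  have h1 : HasDerivAt (fun x : ℝ => (x : ℂ) ^ (p - 1)) ((p - 1) * (y : ℂ) ^ (p - 1 - 1)) y := by
    have := (hasDerivAt_id (y : ℂ)).cpow_const (c := p - 1) (Or.inl (by simpa using hy))
    simpa using this.comp_ofReal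
  have h2 := h1.const_mul (Complex.Gamma p)⁻¹
  refine h2.congr_deriv (Eq.symm ?_)
  change (Complex.Gamma (p - 1))⁻¹ * _ = _
  rw [Complex.one_div_Gamma_eq_self_mul_one_div_Gamma_add_one (p - 1), sub_add_cancel]
  ring

lemma continuousOn_rlKernel (p : ℂ) : ContinuousOn (rlKernel p) (Ioi 0) :=
  fun _ hy => (hasDerivAt_rlKernel p hy).continuousAt.continuousWithinAt

lemma causalReg_rlKernel {p : ℂ} (hp : 0 < p.re) : CausalReg (rlKernel p) := by
  refine ⟨continuousOn_rlKernel p, fun T => ?_⟩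
  have := intervalIntegral.intervalIntegrable_cpow' (a := 0) (b := T) (r := p - 1)
    (by simp [hp])
  exact (this.const_mul _).1

lemma norm_rlKernel (p : ℂ) {y : ℝ} (hy : 0 < y) :
    ‖rlKernel p y‖ = ‖Complex.Gamma p‖⁻¹ * y ^ (p.re - 1) := by
  rw [rlKernel, norm_mul, norm_inv, Complex.norm_cpow_eq_rpow_re_of_pos hy]; simp

/-- The semigroup law is the Beta integral, scaled to `[0, y]`. -/
lemma cconv_rlKernel_rlKernel {p q : ℂ} (hp : 0 < p.re) (hq : 0 < q.re) {y : ℝ} (hy : 0 < y) :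
    cconv (rlKernel p) (rlKernel q) y = rlKernel (p + q) y := by
  have h1 := Complex.betaIntegral_scaled q p hy
  have h2 := Complex.Gamma_mul_Gamma_eq_betaIntegral hq hp
  have hp0 := Complex.Gamma_ne_zero_of_re_pos hp
  have hq0 := Complex.Gamma_ne_zero_of_re_pos hq
  have hpq0 := Complex.Gamma_ne_zero_of_re_pos (s := p + q) (by simp; positivity)
  have h3 : cconv (rlKernel p) (rlKernel q) y = (Complex.Gamma p)⁻¹ * (Complex.Gamma q)⁻¹ *
      ∫ x in (0 : ℝ)..y, (x : ℂ) ^ (q - 1) * ((y : ℂ) - x) ^ (p - 1) := by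
    rw [cconv, ← intervalIntegral.integral_const_mul]
    congr 1; ext t
    simp only [rlKernel]; push_cast; ring
  rw [h3, h1, rlKernel, add_comm q p] at *
  field_simp
  rw [mul_comm (Complex.Gamma p), h2]; ring

lemma cconv_one_eq (f : ℝ → ℂ) (y : ℝ) : cconv (rlKernel 1) f y = ∫ t in (0 : ℝ)..y, f t := by
  simp [cconv, rlKernel_one]

lemma hasDerivAt_cconv_one {f : ℝ → ℂ} (hf : CausalReg f) {y : ℝ} (hy : 0 < y) :
    HasDerivAt (cconv (rlKernel 1) f) (f y) y := by
  have : cconv (rlKernel 1) f = fun y => ∫ t in (0 : ℝ)..y, f t := funext (cconv_one_eq f)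
  rw [this]
  exact intervalIntegral.integral_hasDerivAt_right (hf.intervalIntegrable hy.le)
    (hf.1.stronglyMeasurableAtFilter isOpen_Ioi y hy) (hf.1.continuousAt (Ioi_mem_nhds hy))

lemma cconv_rlKernel_cconv {f : ℝ → ℂ} (hf : CausalReg f) {p q : ℂ} (hp : 0 < p.re)
    (hq : 0 < q.re) {y : ℝ} (hy : 0 < y) :
    cconv (rlKernel p) (cconv (rlKernel q) f) y = cconv (rlKernel (p + q)) f y := by
  rw [← cconv_assoc (causalReg_rlKernel hp) (causalReg_rlKernel hq) hf hy]
  exact cconv_congr (fun t ht => cconv_rlKernel_rlKernel hp hq ht) (fun _ _ => rfl) hy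

/-- Factor out one primitive by the semigroup law; the fundamental theorem of calculus then replaces
differentiation under a singular integral. -/
lemma hasDerivAt_cconv_rlKernel {f : ℝ → ℂ} (hf : CausalReg f) {p : ℂ} (hp : 0 < (p - 1).re)
    {y : ℝ} (hy : 0 < y) :
    HasDerivAt (cconv (rlKernel p) f) (cconv (rlKernel (p - 1)) f y) y := by
  refine (hasDerivAt_cconv_one ((causalReg_rlKernel hp).cconv hf) hy).congr_of_eventuallyEq ?_
  filter_upwards [Ioi_mem_nhds hy] with x hx
  rw [cconv_rlKernel_cconv hf (by simp) hp hx]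
  ring_nf

lemma tendsto_integral_zero {f : ℝ → ℂ} (hf : CausalReg f) :
    Tendsto (fun y => ∫ t in (0 : ℝ)..y, ‖f t‖) (𝓝[>] 0) (𝓝 0) := by
  have h := intervalIntegral.continuousOn_primitive_interval (a := 0) (b := 1) (f := fun t => ‖f t‖)
    (μ := volume) (by
      rw [uIcc_of_le zero_le_one, integrableOn_Icc_iff_integrableOn_Ioc]; exact (hf.2 1).norm)
  have h1 := h 0 (by simp)
  rw [ContinuousWithinAt, intervalIntegral.integral_same] at h1
  refine h1.mono_left ?_
  rw [uIcc_of_le zero_le_one]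
  exact nhdsWithin_le_iff.2 (mem_of_superset (Ioo_mem_nhdsGT one_pos) Ioo_subset_Icc_self)

/-- On `(0, 1)` a kernel of order with real part at least `1` is bounded by `1/‖Γ p‖`. This is what
makes the early initial values vanish. -/
lemma tendsto_cconv_rlKernel_zero {f : ℝ → ℂ} (hf : CausalReg f) {p : ℂ} (hp : 1 ≤ p.re) :
    Tendsto (cconv (rlKernel p) f) (𝓝[>] 0) (𝓝 0) := by
  have h := (tendsto_integral_zero hf).const_mul ‖Complex.Gamma p‖⁻¹
  rw [mul_zero] at h
  refine squeeze_zero_norm' ?_ h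
  filter_upwards [Ioo_mem_nhdsGT (zero_lt_one (α := ℝ))] with y hy
  have hk := causalReg_rlKernel (p := p) (by linarith)
  refine (norm_cconv_le hy.1).trans ?_
  rw [← intervalIntegral.integral_const_mul]
  simp only [cconv, intervalIntegral.integral_of_le hy.1.le, integral_Ioc_eq_integral_Ioo]
  refine setIntegral_mono_on ?_ ?_ measurableSet_Ioo fun t ht => ?_
  · have := hk.norm.intervalIntegrable_cconv hf.norm hy.1
    rwa [intervalIntegrable_iff_integrableOn_Ioo_of_le hy.1.le] at this
  · exact ((hf.2 y).mono_set Ioo_subset_Ioc_self).norm.const_mul _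
  · have h1 : 0 < y - t := by linarith [ht.2]
    rw [norm_rlKernel p h1]
    have h2 : (y - t) ^ (p.re - 1) ≤ 1 :=
      Real.rpow_le_one h1.le (by linarith [ht.1, hy.2]) (by linarith)
    gcongr
    exact mul_le_of_le_one_right (by positivity) h2

lemma lapConv_rlKernel {p s : ℂ} (hp : 0 < p.re) (hs : 0 < s.re) : LapConv (rlKernel p) s := by
  have h := integrableOn_rpow_mul_exp_neg_mul_rpow (p := 1) (s := p.re - 1) (b := s.re)
    (by linarith) one_pos hs
  refine Integrable.mono' (h.const_mul ‖Complex.Gamma p‖⁻¹) ?_ ?_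
  · exact ((by fun_prop : Continuous fun y : ℝ => Complex.exp (-s * y)).continuousOn.mul
      (continuousOn_rlKernel p)).aestronglyMeasurable measurableSet_Ioi
  · rw [ae_restrict_iff' measurableSet_Ioi]
    refine Eventually.of_forall fun y hy => le_of_eq ?_
    rw [norm_mul, norm_cexp_neg_mul, norm_rlKernel p hy, Real.rpow_one]
    ring_nf

/-- For real `s` this is the Gamma integral; both sides are holomorphic on the right half-plane and
agree at the points `1 + 1/(n+1)` accumulating at `1`. -/
lemma lap_rlKernel {p s : ℂ} (hp : 0 < p.re) (hs : 0 < s.re) : lap (rlKernel p) s = s ^ (-p) := by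
  have hopen : IsOpen {z : ℂ | 0 < z.re} := isOpen_lt continuous_const Complex.continuous_re
  have hd : DifferentiableOn ℂ (lap (rlKernel p)) {z | 0 < z.re} := by
    intro z hz
    have hz : 0 < z.re := hz
    have h := differentiableOn_lap (lapConv_rlKernel hp (s := (z.re / 2 : ℝ)) (by simpa using hz))
    exact ((h z (by simpa using hz)).differentiableAt ((isOpen_lt continuous_const
      Complex.continuous_re).mem_nhds (by simpa using hz))).differentiableWithinAt
  have hd2 : DifferentiableOn ℂ (fun z : ℂ => z ^ (-p)) {z | 0 < z.re} := by
    intro z hz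
    exact (differentiableAt_id.cpow_const (Or.inl hz)).differentiableWithinAt
  have hreal : ∀ r : ℝ, 0 < r → lap (rlKernel p) r = (r : ℂ) ^ (-p) := by
    intro r hr
    have h := Complex.integral_cpow_mul_exp_neg_mul_Ioi hp hr
    have hG := Complex.Gamma_ne_zero_of_re_pos hp
    have : lap (rlKernel p) r = (Complex.Gamma p)⁻¹ * ((1 / r) ^ p * Complex.Gamma p) := by
      rw [← h, ← integral_const_mul]
      refine setIntegral_congr_fun measurableSet_Ioi fun y hy => ?_
      simp only [rlKernel, neg_mul]
      ring
    rw [this, one_div, Complex.inv_cpow _ _ (by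
      rw [Complex.arg_ofReal_of_nonneg hr.le]; exact Real.pi_pos.ne), Complex.cpow_neg]
    field_simp
  refine (hd.analyticOnNhd hopen).eqOn_of_preconnected_of_frequently_eq (z₀ := 1)
    (hd2.analyticOnNhd hopen) (convex_halfSpace_re_gt 0).isPreconnected (by simp) ?_ hs
  have ht : Tendsto (fun n : ℕ => ((1 + 1 / ((n : ℝ) + 1) : ℝ) : ℂ)) atTop (𝓝[≠] 1) := by
    refine tendsto_nhdsWithin_iff.2 ⟨?_, Eventually.of_forall fun n => ?_⟩
    · have h1 := (tendsto_one_div_add_atTop_nhds_zero_nat (𝕜 := ℝ)).const_add 1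
      rw [add_zero] at h1
      have h2 := (Complex.continuous_ofReal.tendsto 1).comp h1
      simpa [Function.comp_def] using h2
    · have : (0 : ℝ) < 1 / ((n : ℝ) + 1) := by positivity
      simp only [mem_compl_iff, mem_singleton_iff]
      rw [← Complex.ofReal_one, Complex.ofReal_inj]
      linarith
  refine ht.frequently (Frequently.of_forall fun n => hreal _ (by positivity))

/-! ### Series of power kernels -/

/-- Sequences of at most geometric growth. -/
def GeomBdd (b : ℕ → ℂ) : Prop := ∃ C R : ℝ, 0 < C ∧ 0 < R ∧ ∀ n, ‖b n‖ ≤ C * R ^ n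

lemma GeomBdd.shift {b : ℕ → ℂ} (hb : GeomBdd b) (k : ℕ) : GeomBdd fun n => b (n + k) := by
  obtain ⟨C, R, hC, hR, h⟩ := hb
  refine ⟨C * R ^ k, R, by positivity, hR, fun n => (h _).trans_eq ?_⟩
  rw [pow_add]; ring

/-- The real power kernel `y ^ (x - 1) / Γ(x)`. -/
def realKernel (x y : ℝ) : ℝ := (Real.Gamma x)⁻¹ * y ^ (x - 1)

lemma rlKernel_ofReal (x : ℝ) {y : ℝ} (hy : 0 ≤ y) : rlKernel (x : ℂ) y = (realKernel x y : ℂ) := by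
  rw [rlKernel, realKernel, Complex.Gamma_ofReal]
  push_cast
  rw [Complex.ofReal_cpow hy]; push_cast; rfl

lemma cconv_realKernel {x z : ℝ} (hx : 0 < x) (hz : 0 < z) {y : ℝ} (hy : 0 < y) :
    cconv (realKernel x) (realKernel z) y = realKernel (x + z) y := by
  have h := cconv_rlKernel_rlKernel (p := x) (q := z) (by simpa) (by simpa) hy
  rw [← Complex.ofReal_add, rlKernel_ofReal _ hy.le] at h
  rw [← Complex.ofReal_inj, ← h, cconv, cconv, ← intervalIntegral.integral_ofReal]
  refine intervalIntegral.integral_congr fun t ht => ?_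
  rw [uIcc_of_le hy.le] at ht
  rw [rlKernel_ofReal _ (by linarith [ht.2]), rlKernel_ofReal _ ht.1]
  push_cast; rfl

/-- The quotient `Γ(Re p) / |Γ(p)|`. -/
def gammaRatio (p : ℂ) : ℝ := ‖Complex.Gamma p‖⁻¹ * Real.Gamma p.re

lemma gammaRatio_pos {p : ℂ} (hp : 0 < p.re) : 0 < gammaRatio p :=
  mul_pos (inv_pos.2 (norm_pos_iff.2 (Complex.Gamma_ne_zero_of_re_pos hp)))
    (Real.Gamma_pos_of_pos hp)

lemma norm_rlKernel_eq {p : ℂ} (hp : 0 < p.re) {y : ℝ} (hy : 0 < y) :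
    ‖rlKernel p y‖ = gammaRatio p * realKernel p.re y := by
  have := (Real.Gamma_pos_of_pos hp).ne'
  rw [norm_rlKernel p hy, gammaRatio, realKernel]
  field_simp

/-- Take norms in the semigroup law at `y = 1`. Submultiplicativity bounds `Γ(Re p)/‖Γ p‖`
geometrically along `βn + q`, with no need for Stirling's formula at complex arguments. -/
lemma gammaRatio_add_le {p q : ℂ} (hp : 0 < p.re) (hq : 0 < q.re) :
    gammaRatio (p + q) ≤ gammaRatio p * gammaRatio q := by
  have hpq : 0 < (p + q).re := by simp; positivity
  have h := norm_cconv_le (f := rlKernel p) (g := rlKernel q) one_pos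
  rw [cconv_rlKernel_rlKernel hp hq one_pos, norm_rlKernel_eq hpq one_pos,
    cconv_congr (fun y hy => norm_rlKernel_eq hp hy) (fun y hy => norm_rlKernel_eq hq hy) one_pos,
    cconv_const_mul_left, cconv_comm, cconv_const_mul_left, cconv_comm,
    cconv_realKernel hp hq one_pos, ← Complex.add_re, ← mul_assoc] at h
  refine le_of_mul_le_mul_right h ?_
  have := Real.Gamma_pos_of_pos hpq
  simp only [realKernel, Real.one_rpow]; positivity

lemma gammaRatio_nat_mul_add_le {β q : ℂ} (hβ : 0 < β.re) (hq : 0 < q.re) (n : ℕ) :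
    gammaRatio (β * n + q) ≤ gammaRatio q * gammaRatio β ^ n := by
  induction n with
  | zero => simp
  | succ n ih =>
    have h : β * ((n + 1 : ℕ) : ℂ) + q = (β * n + q) + β := by push_cast; ring
    have h0 : 0 < (β * n + q).re := by simp; positivity
    have := (gammaRatio_pos hβ).le
    rw [h, pow_succ, ← mul_assoc]
    exact (gammaRatio_add_le h0 hβ).trans (by gcongr)

/-- Restrict the Gamma integral to `(z, ∞)`, where `t ^ x ≥ z ^ x`. -/
lemma rpow_le_exp_mul_Gamma {x z : ℝ} (hx : 0 ≤ x) (hz : 0 ≤ z) :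
    z ^ x ≤ Real.exp z * Real.Gamma (x + 1) := by
  have h := Real.GammaIntegral_convergent (s := x + 1) (by linarith)
  have h1 : z ^ x * Real.exp (-z) ≤ Real.Gamma (x + 1) := by
    rw [Real.Gamma_eq_integral (by linarith), ← integral_exp_neg_Ioi, ← integral_const_mul]
    simp only [add_sub_cancel_right] at h ⊢
    calc ∫ t in Ioi z, z ^ x * Real.exp (-t) ≤ ∫ t in Ioi z, Real.exp (-t) * t ^ x := by
          refine setIntegral_mono_on ((integrableOn_exp_neg_Ioi z).const_mul _)
            (h.mono_set (Ioi_subset_Ioi hz)) measurableSet_Ioi fun t ht => ?_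
          rw [mul_comm]
          gcongr
          exact le_of_lt ht
      _ ≤ _ := by
          refine setIntegral_mono_set h ?_ (Ioi_subset_Ioi hz).eventuallyLE
          rw [EventuallyLE, ae_restrict_iff' measurableSet_Ioi]
          refine Eventually.of_forall fun t ht => ?_
          have ht : 0 < t := ht
          simp only [Pi.zero_apply]
          positivity
  rw [Real.exp_neg, ← div_eq_mul_inv, div_le_iff₀ (Real.exp_pos z)] at h1
  linarith

lemma realKernel_le {x y L : ℝ} (hx : 0 < x) (hy : 0 < y) (hL : 0 < L) :
    realKernel x y ≤ y⁻¹ * Real.exp (L * y) * (Real.exp 1 / L) ^ x := by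
  have h := rpow_le_exp_mul_Gamma hx.le (mul_pos hL hy).le
  rw [Real.Gamma_add_one hx.ne', Real.mul_rpow hL.le hy.le] at h
  have hG := Real.Gamma_pos_of_pos hx
  have hx1 : x ≤ Real.exp x := by linarith [Real.add_one_le_exp x]
  have hLx : 0 < L ^ x := Real.rpow_pos_of_pos hL x
  rw [realKernel, Real.rpow_sub_one hy.ne', Real.div_rpow (Real.exp_pos 1).le hL.le,
    ← Real.exp_mul, one_mul]
  have h2 : y ^ x ≤ Real.exp (L * y) * (Real.exp x / L ^ x) * Real.Gamma x := by
    rw [mul_div_assoc', div_mul_eq_mul_div, le_div_iff₀ hLx]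
    calc y ^ x * L ^ x = L ^ x * y ^ x := mul_comm _ _
      _ ≤ Real.exp (L * y) * (x * Real.Gamma x) := h
      _ ≤ Real.exp (L * y) * (Real.exp x * Real.Gamma x) := by gcongr
      _ = _ := by ring
  calc (Real.Gamma x)⁻¹ * (y ^ x / y)
      ≤ (Real.Gamma x)⁻¹ * (Real.exp (L * y) * (Real.exp x / L ^ x) * Real.Gamma x / y) := by
        gcongr
    _ = _ := by field_simp

lemma exists_realKernel_bound {K b c : ℝ} (hK : 0 < K) (hb : 0 < b) (hc : 0 < c) :
    ∃ M L : ℝ, 0 < M ∧ 0 < L ∧ ∀ (n : ℕ) (y : ℝ), 0 < y →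
      K ^ n * realKernel (n * b + c) y ≤ M * (1 / 2) ^ n * (y ^ (c - 1) + Real.exp (L * y)) := by
  -- Chosen so that `(e / L) ^ b = 1 / (2K)`, which beats the factor `K ^ n` and leaves `(1/2) ^ n`.
  set L := Real.exp 1 * (2 * K) ^ (1 / b) with hL
  have hL0 : 0 < L := by positivity
  have h0 : Real.exp 1 / L = (2 * K) ^ (-(1 / b)) := by
    rw [hL, Real.rpow_neg (by positivity)]; field_simp
  have h1 : ∀ n : ℕ, K ^ n * (Real.exp 1 / L) ^ (n * b + c) =
      (Real.exp 1 / L) ^ c * (1 / 2) ^ n := by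
    intro n
    have h2 : (Real.exp 1 / L) ^ (n * b) = ((2 * K)⁻¹) ^ n := by
      rw [h0, ← Real.rpow_mul (by positivity), ← Real.rpow_natCast, Real.inv_rpow (by positivity),
        ← Real.rpow_neg (by positivity)]
      congr 1; field_simp
    rw [Real.rpow_add (by positivity), h2, mul_inv, mul_pow, one_div]
    have : K ^ n * K⁻¹ ^ n = 1 := by rw [← mul_pow, mul_inv_cancel₀ hK.ne', one_pow]
    linear_combination (2⁻¹ ^ n * (Real.exp 1 / L) ^ c) * this
  have h3 : ∀ (n : ℕ) (y : ℝ), 0 < y → K ^ n * realKernel (n * b + c) y ≤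
      (Real.exp 1 / L) ^ c * (1 / 2) ^ n * (y⁻¹ * Real.exp (L * y)) := by
    intro n y hy
    have := realKernel_le (x := n * b + c) (by positivity) hy hL0
    calc _ ≤ K ^ n * (y⁻¹ * Real.exp (L * y) * (Real.exp 1 / L) ^ (n * b + c)) := by gcongr
      _ = y⁻¹ * Real.exp (L * y) * (K ^ n * (Real.exp 1 / L) ^ (n * b + c)) := by ring
      _ = _ := by rw [h1]; ring
  refine ⟨(Real.exp 1 / L) ^ c * Real.exp L, L, by positivity, hL0, fun n y hy => ?_⟩
  have hpos : 0 < y ^ (c - 1) := Real.rpow_pos_of_pos hy _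
  -- Below `1`, lowering the exponent to `c - 1` reduces to the bound at `y = 1`; above `1` the
  -- factor `y⁻¹` is harmless.
  rcases le_total y 1 with hy1 | hy1
  · have h4 : realKernel (n * b + c) y ≤ realKernel (n * b + c) 1 * y ^ (c - 1) := by
      have hG := Real.Gamma_pos_of_pos (s := n * b + c) (by positivity)
      simp only [realKernel, Real.one_rpow, mul_one]
      exact mul_le_mul_of_nonneg_left (Real.rpow_le_rpow_of_exponent_ge hy hy1
        (by linarith [show 0 ≤ n * b by positivity])) (inv_pos.2 hG).le
    have h5 := h3 n 1 one_pos
    rw [inv_one, one_mul, mul_one] at h5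
    calc _ ≤ K ^ n * (realKernel (n * b + c) 1 * y ^ (c - 1)) := by gcongr
      _ = (K ^ n * realKernel (n * b + c) 1) * y ^ (c - 1) := by ring
      _ ≤ ((Real.exp 1 / L) ^ c * (1 / 2) ^ n * Real.exp L) * y ^ (c - 1) := by gcongr
      _ = (Real.exp 1 / L) ^ c * Real.exp L * (1 / 2) ^ n * y ^ (c - 1) := by ring
      _ ≤ _ := by gcongr; linarith [Real.exp_pos (L * y)]
  · refine (h3 n y hy).trans ?_
    have h6 : 1 ≤ Real.exp L := Real.one_le_exp hL0.le
    have h7 : y⁻¹ ≤ 1 := inv_le_one_of_one_le₀ hy1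
    calc _ ≤ (Real.exp 1 / L) ^ c * (1 / 2) ^ n * (1 * Real.exp (L * y)) := by gcongr
      _ = (Real.exp 1 / L) ^ c * 1 * (1 / 2) ^ n * Real.exp (L * y) := by ring
      _ ≤ (Real.exp 1 / L) ^ c * Real.exp L * (1 / 2) ^ n * Real.exp (L * y) := by gcongr
      _ ≤ _ := by gcongr; linarith

/-- The growth of `bₙ` and of `gammaRatio (βn + q)` combine into one geometric factor, which the
Gamma function absorbs. This single majorant justifies all termwise operations on the series kernel.
-/
lemma GeomBdd.exists_bound {b : ℕ → ℂ} (hb : GeomBdd b) {β q : ℂ} (hβ : 0 < β.re) (hq : 0 < q.re) :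
    ∃ A L : ℝ, 0 < A ∧ 0 < L ∧ ∀ (n : ℕ) (y : ℝ), 0 < y → ‖b n * rlKernel (β * n + q) y‖ ≤
      A * (1 / 2) ^ n * (y ^ (q.re - 1) + Real.exp (L * y)) := by
  obtain ⟨C, R, hC, hR, h⟩ := hb
  have hβ0 := gammaRatio_pos hβ
  have hq0 := gammaRatio_pos hq
  obtain ⟨M, L, hM, hL, hML⟩ := exists_realKernel_bound (mul_pos hR hβ0) hβ hq
  refine ⟨C * gammaRatio q * M, L, by positivity, hL, fun n y hy => ?_⟩
  have hre : (β * n + q).re = n * β.re + q.re := by simp [mul_comm]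
  have hn0 : 0 < (β * n + q).re := by rw [hre]; positivity
  have hk : 0 ≤ realKernel (β * n + q).re y := by
    have := Real.Gamma_pos_of_pos hn0
    rw [realKernel]; positivity
  rw [norm_mul, norm_rlKernel_eq hn0 hy]
  have h1 := gammaRatio_nat_mul_add_le hβ hq n
  calc _ ≤ (C * R ^ n) * ((gammaRatio q * gammaRatio β ^ n) * realKernel (β * n + q).re y) := by
        have := gammaRatio_pos hn0
        gcongr
        exact h n
    _ = C * gammaRatio q * ((R * gammaRatio β) ^ n * realKernel (n * β.re + q.re) y) := by
        rw [hre, mul_pow]; ring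
    _ ≤ C * gammaRatio q * (M * (1 / 2) ^ n * (y ^ (q.re - 1) + Real.exp (L * y))) :=
        mul_le_mul_of_nonneg_left (hML n y hy) (by positivity)
    _ = _ := by ring

/-- The kernel `∑ bₙ y ^ (β n + q - 1) / Γ(β n + q)`. -/
def seriesKernel (b : ℕ → ℂ) (β q : ℂ) (y : ℝ) : ℂ := ∑' n : ℕ, b n * rlKernel (β * n + q) y

lemma LapConv.integrableOn_Ioc {f : ℝ → ℂ} {s : ℂ} (h : LapConv f s) (T : ℝ) :
    IntegrableOn f (Ioc 0 T) := by
  rcases le_or_gt T 0 with hT | hT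
  · simp [Ioc_eq_empty_of_le hT]
  have h1 : IntervalIntegrable (fun y : ℝ => Complex.exp (-s * y) * f y) volume 0 T :=
    (intervalIntegrable_iff_integrableOn_Ioc_of_le hT.le).2 (IntegrableOn.mono_set h
      Ioc_subset_Ioi_self)
  have hc : Continuous fun y : ℝ => Complex.exp (s * y) := by fun_prop
  have h2 := (h1.continuousOn_mul hc.continuousOn).1
  refine h2.congr_fun (fun y _ => ?_) measurableSet_Ioc
  change Complex.exp (s * y) * (Complex.exp (-s * y) * f y) = f y
  rw [← mul_assoc, ← Complex.exp_add]; simp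

section SeriesKernel

variable {b : ℕ → ℂ} {β q : ℂ}

lemma GeomBdd.summable (hb : GeomBdd b) (hβ : 0 < β.re) (hq : 0 < q.re) {y : ℝ} (hy : 0 < y) :
    Summable fun n : ℕ => b n * rlKernel (β * n + q) y := by
  obtain ⟨A, L, -, -, h⟩ := hb.exists_bound hβ hq
  exact Summable.of_norm_bounded ((summable_geometric_two.mul_left A).mul_right _)
    fun n => h n y hy

lemma GeomBdd.continuousOn_seriesKernel (hb : GeomBdd b) (hβ : 0 < β.re) (hq : 0 < q.re) :
    ContinuousOn (seriesKernel b β q) (Ioi 0) := by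
  obtain ⟨A, L, hA, hL, h⟩ := hb.exists_bound hβ hq
  intro y₀ hy₀
  have hy₀ : 0 < y₀ := hy₀
  refine ContinuousAt.continuousWithinAt ?_
  have hD : ContinuousOn (fun y : ℝ => y ^ (q.re - 1) + Real.exp (L * y)) (Icc (y₀ / 2) (2 * y₀)) :=
    (continuousOn_id.rpow_const fun y hy => Or.inl (by
      simp only [id]; linarith [hy.1])).add (by fun_prop)
  obtain ⟨B, hB⟩ := isCompact_Icc.exists_bound_of_continuousOn hD
  refine ContinuousOn.continuousAt (s := Icc (y₀ / 2) (2 * y₀)) ?_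
    (Icc_mem_nhds (by linarith) (by linarith))
  refine continuousOn_tsum (u := fun n => A * (1 / 2) ^ n * B) (fun n => ?_)
    ((summable_geometric_two.mul_left A).mul_right _) fun n y hy => ?_
  · exact continuousOn_const.mul ((continuousOn_rlKernel _).mono fun y hy => by
      simp only [mem_Ioi]; linarith [hy.1])
  · refine (h n y (by linarith [hy.1])).trans ?_
    gcongr
    exact (le_abs_self _).trans (hB y hy)

lemma GeomBdd.exists_lapConv_seriesKernel (hb : GeomBdd b) (hβ : 0 < β.re) (hq : 0 < q.re) :
    ∃ L : ℝ, 0 < L ∧ ∀ s : ℂ, L < s.re → LapConv (seriesKernel b β q) s ∧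
      HasSum (fun n : ℕ => b n * s ^ (-(β * n + q))) (lap (seriesKernel b β q) s) := by
  obtain ⟨A, L, hA, hL, h⟩ := hb.exists_bound hβ hq
  refine ⟨L, hL, fun s hs => ?_⟩
  have hs0 : 0 < s.re := hL.trans hs
  have hre : ∀ n : ℕ, 0 < (β * n + q).re := fun n => by simp; positivity
  have hD : IntegrableOn (fun y : ℝ => Real.exp (-(s.re * y)) *
      (y ^ (q.re - 1) + Real.exp (L * y))) (Ioi 0) := by
    have h1 := integrableOn_rpow_mul_exp_neg_mul_rpow (p := 1) (s := q.re - 1) (b := s.re)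
      (by linarith) one_pos hs0
    have h2 := integrableOn_exp_mul_Ioi (a := -(s.re - L)) (by linarith) 0
    refine (Integrable.add h1 h2).congr (Eventually.of_forall fun y => ?_)
    simp only [Real.rpow_one, Pi.add_apply, mul_add]
    rw [← Real.exp_add]
    ring_nf
  have hbd : ∀ n : ℕ, ∀ y : ℝ, 0 < y → ‖Complex.exp (-s * y) * (b n * rlKernel (β * n + q) y)‖ ≤
      A * (1 / 2) ^ n * (Real.exp (-(s.re * y)) * (y ^ (q.re - 1) + Real.exp (L * y))) := by
    intro n y hy
    rw [norm_mul, norm_cexp_neg_mul, mul_left_comm]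
    exact mul_le_mul_of_nonneg_left (h n y hy) (Real.exp_pos _).le
  have hgeo : ∀ D : ℝ, Summable fun n : ℕ => A * (1 / 2) ^ n * D := fun D =>
    (summable_geometric_two.mul_left A).mul_right D
  have hmeas : ∀ f : ℝ → ℂ, ContinuousOn f (Ioi 0) → AEStronglyMeasurable
      (fun y : ℝ => Complex.exp (-s * y) * f y) (volume.restrict (Ioi 0)) := fun f hf =>
    ((by fun_prop : Continuous fun y : ℝ => Complex.exp (-s * y)).continuousOn.mul
      hf).aestronglyMeasurable measurableSet_Ioi
  have hsum : ∀ y : ℝ, 0 < y → HasSum (fun n : ℕ => Complex.exp (-s * y) *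
      (b n * rlKernel (β * n + q) y)) (Complex.exp (-s * y) * seriesKernel b β q y) :=
    fun y hy => (hb.summable hβ hq hy).hasSum.mul_left _
  constructor
  · refine (hD.const_mul (A * 2)).mono' (hmeas _ (hb.continuousOn_seriesKernel hβ hq)) ?_
    rw [ae_restrict_iff' measurableSet_Ioi]
    refine Eventually.of_forall fun y hy => ?_
    rw [← (hsum y hy).tsum_eq]
    refine tsum_of_norm_bounded ?_ fun n => hbd n y hy
    exact (hasSum_geometric_two.mul_left A).mul_right _
  · have key := hasSum_integral_of_dominated_convergence (μ := volume.restrict (Ioi (0 : ℝ)))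
      (F := fun (n : ℕ) (y : ℝ) => Complex.exp (-s * y) * (b n * rlKernel (β * n + q) y))
      (f := fun y : ℝ => Complex.exp (-s * y) * seriesKernel b β q y)
      (fun n y => A * (1 / 2) ^ n *
        (Real.exp (-(s.re * y)) * (y ^ (q.re - 1) + Real.exp (L * y))))
      (fun n => hmeas _ (continuousOn_const.mul (continuousOn_rlKernel _)))
      (fun n => by
        rw [ae_restrict_iff' measurableSet_Ioi]
        exact Eventually.of_forall fun y hy => hbd n y hy)
      (Eventually.of_forall fun y => hgeo _) ?_ ?_
    · refine key.congr_fun ?_ |> fun h => h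
      intro n
      have := lap_const_mul (b n) (rlKernel (β * n + q)) s
      rw [lap_rlKernel (hre n) hs0] at this
      exact this.symm
    · simp_rw [tsum_mul_right]
      exact hD.const_mul _
    · rw [ae_restrict_iff' measurableSet_Ioi]
      exact Eventually.of_forall hsum

lemma GeomBdd.causalReg_seriesKernel (hb : GeomBdd b) (hβ : 0 < β.re) (hq : 0 < q.re) :
    CausalReg (seriesKernel b β q) := by
  obtain ⟨L, -, h⟩ := hb.exists_lapConv_seriesKernel hβ hq
  exact ⟨hb.continuousOn_seriesKernel hβ hq,
    (h ((L + 1 : ℝ) : ℂ) (by simp)).1.integrableOn_Ioc⟩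

/-- The semigroup law applied term by term. It allows a tail of the kernel to be recognised as an
iterated primitive. -/
lemma GeomBdd.cconv_rlKernel_seriesKernel (hb : GeomBdd b) (hβ : 0 < β.re) (hq : 0 < q.re) {p : ℂ}
    (hp : 0 < p.re) {y : ℝ} (hy : 0 < y) :
    cconv (rlKernel p) (seriesKernel b β q) y = seriesKernel b β (q + p) y := by
  obtain ⟨A, L, hA, hL, h⟩ := hb.exists_bound hβ hq
  have hre : ∀ n : ℕ, 0 < (β * n + q).re := fun n => by simp; positivity
  have hD : CausalReg (fun y : ℝ => y ^ (q.re - 1) + Real.exp (L * y)) := by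
    refine ⟨(continuousOn_id.rpow_const fun y hy => Or.inl (ne_of_gt hy)).add (by fun_prop),
      fun T => ?_⟩
    exact ((intervalIntegral.intervalIntegrable_rpow' (by linarith)).add
      (Continuous.intervalIntegrable (by fun_prop) _ _)).1
  have hint := (causalReg_rlKernel hp).norm.intervalIntegrable_cconv hD hy
  rw [intervalIntegrable_iff_integrableOn_Ioo_of_le hy.le] at hint
  have key := hasSum_integral_of_dominated_convergence (μ := volume.restrict (Ioo (0 : ℝ) y))
      (F := fun (n : ℕ) (t : ℝ) => rlKernel p (y - t) * (b n * rlKernel (β * n + q) t))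
      (f := fun t : ℝ => rlKernel p (y - t) * seriesKernel b β q t)
      (fun n t => A * (1 / 2) ^ n *
        (‖rlKernel p (y - t)‖ * (t ^ (q.re - 1) + Real.exp (L * t)))) ?_ ?_
      (Eventually.of_forall fun t => (summable_geometric_two.mul_left A).mul_right _) ?_ ?_
  · rw [cconv, intervalIntegral.integral_of_le hy.le, integral_Ioc_eq_integral_Ioo, ← key.tsum_eq,
      seriesKernel]
    congr 1
    ext n
    rw [← integral_Ioc_eq_integral_Ioo, ← intervalIntegral.integral_of_le hy.le]
    simp_rw [mul_left_comm _ (b n)]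
    rw [intervalIntegral.integral_const_mul]
    change b n * cconv (rlKernel p) (rlKernel (β * n + q)) y = _
    rw [cconv_rlKernel_rlKernel hp (hre n) hy]
    ring_nf
  · intro n
    have := (causalReg_rlKernel hp).intervalIntegrable_cconv
      ((causalReg_rlKernel (hre n)).const_mul (b n)) hy
    rw [intervalIntegrable_iff_integrableOn_Ioo_of_le hy.le] at this
    exact this.aestronglyMeasurable
  · intro n
    rw [ae_restrict_iff' measurableSet_Ioo]
    refine Eventually.of_forall fun t ht => ?_
    rw [norm_mul, mul_left_comm]
    exact mul_le_mul_of_nonneg_left (h n t ht.1) (norm_nonneg _)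
  · simp_rw [tsum_mul_right]
    exact hint.const_mul _
  · rw [ae_restrict_iff' measurableSet_Ioo]
    exact Eventually.of_forall fun t ht => (hb.summable hβ hq ht.1).hasSum.mul_left _

end SeriesKernel

/-! ### Reciprocals of convergent power series -/

lemma HasPosRadius.exists_geometric_bound {c : ℕ → ℂ} (hc : HasPosRadius c) : GeomBdd c := by
  obtain ⟨r, hr, hs⟩ := hc
  have hb : ∀ n, ‖c n‖ * r ^ n ≤ ∑' k, ‖c k‖ * r ^ k := fun n =>
    hs.le_tsum n fun k _ => by positivity
  have h0 : 0 ≤ ∑' k, ‖c k‖ * r ^ k := tsum_nonneg fun k => by positivity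
  refine ⟨(∑' k, ‖c k‖ * r ^ k) + 1, r⁻¹, by positivity, by positivity, fun n => ?_⟩
  rw [inv_pow, ← div_eq_mul_inv, le_div_iff₀ (by positivity)]
  linarith [hb n]

lemma GeomBdd.of_mul_eq_one {c b : ℕ → ℂ} (hc : GeomBdd c)
    (h : PowerSeries.mk c * PowerSeries.mk b = 1) : GeomBdd b := by
  obtain ⟨C, R, hC, hR, hcb⟩ := hc
  have h0 : c 0 * b 0 = 1 := by
    have := congrArg (PowerSeries.coeff 0) h
    simpa [PowerSeries.coeff_mul] using this
  have hb0 : b 0 ≠ 0 := right_ne_zero_of_mul_eq_one h0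
  set B := ‖b 0‖ with hB
  have hB0 : 0 < B := norm_pos_iff.2 hb0
  -- With this ratio `C * B * R = S - R`, so the geometric sum produced by the recursion telescopes
  -- to `S ^ (n+1) - R ^ (n+1)`.
  set S := R * (1 + B * C) with hS
  have hRS : R < S := by rw [hS]; nlinarith [mul_pos hR (mul_pos hB0 hC)]
  have hS0 : 0 < S := hR.trans hRS
  -- Because `c 0 * b 0 = 1`, solving the Cauchy product for `b (n + 1)` means multiplying by `b 0`.
  have hrec : ∀ n : ℕ, b (n + 1) = -b 0 * ∑ k ∈ Finset.range (n + 1), c (k + 1) * b (n - k) := by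
    intro n
    have h1 := congrArg (PowerSeries.coeff (n + 1)) h
    rw [PowerSeries.coeff_mul, PowerSeries.coeff_one, if_neg (by omega)] at h1
    simp only [PowerSeries.coeff_mk] at h1
    rw [Finset.Nat.sum_antidiagonal_eq_sum_range_succ (fun i j => c i * b j) (n + 1),
      Finset.sum_range_succ'] at h1
    simp only [Nat.add_sub_add_right, Nat.sub_zero] at h1
    linear_combination b 0 * h1 - b (n + 1) * h0
  refine ⟨B, S, hB0, hS0, fun n => ?_⟩
  induction n using Nat.strong_induction_on with
  | _ n ih =>
    rcases n with _ | n
    · simp [hB]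
    · rw [hrec, norm_mul, norm_neg]
      refine mul_le_mul_of_nonneg_left ?_ hB0.le
      have h2 : ∀ k ∈ Finset.range (n + 1),
          ‖c (k + 1) * b (n - k)‖ ≤ C * B * R * (R ^ k * S ^ (n - k)) := by
        intro k hk
        rw [norm_mul]
        calc _ ≤ (C * R ^ (k + 1)) * (B * S ^ (n - k)) := by
              gcongr
              · exact hcb _
              · exact ih _ (by omega)
          _ = _ := by ring
      refine (norm_sum_le_of_le _ h2).trans ?_
      rw [← Finset.mul_sum]
      have h3 := (Commute.all R S).geom_sum₂_mul (n + 1)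
      have h4 : C * B * R = S - R := by rw [hS]; ring
      have h5 : (S - R) * ∑ k ∈ Finset.range (n + 1), R ^ k * S ^ (n - k) =
          S ^ (n + 1) - R ^ (n + 1) := by
        have : ∀ k, n + 1 - 1 - k = n - k := fun k => by omega
        simp only [this] at h3
        linear_combination -h3
      rw [h4, h5]
      linarith [pow_pos hR (n + 1)]

/-! ### Chains of derivatives -/

/-- `F` differs from the primitive of `f` by a constant, so integrability of the derivative at `0`
already forces a limit there. Downward induction then controls a whole chain from its last member.
-/
lemma exists_eq_add_cconv_one {F f : ℝ → ℂ} (hf : CausalReg f)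
    (hF : ∀ y, 0 < y → HasDerivAt F (f y) y) :
    ∃ l : ℂ, Tendsto F (𝓝[>] 0) (𝓝 l) ∧ ∀ y, 0 < y → F y = l + cconv (rlKernel 1) f y := by
  have hd : ∀ y, 0 < y → HasDerivAt (fun y => F y - cconv (rlKernel 1) f y) 0 y := by
    intro y hy
    simpa using (hF y hy).fun_sub (hasDerivAt_cconv_one hf hy)
  have hconst : ∀ y, 0 < y → F y - cconv (rlKernel 1) f y = F 1 - cconv (rlKernel 1) f 1 := by
    intro y hy
    exact isOpen_Ioi.is_const_of_deriv_eq_zero (convex_Ioi (0 : ℝ)).isPreconnected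
      (fun y hy => (hd y hy).differentiableAt.differentiableWithinAt)
      (fun y hy => (hd y hy).deriv) (mem_Ioi.2 hy) (mem_Ioi.2 one_pos)
  have h : ∀ y, 0 < y → F y = (F 1 - cconv (rlKernel 1) f 1) + cconv (rlKernel 1) f y :=
    fun y hy => by rw [← hconst y hy]; ring
  refine ⟨_, ?_, h⟩
  have ht := (tendsto_cconv_rlKernel_zero hf (p := 1) (by simp)).const_add
    (F 1 - cconv (rlKernel 1) f 1)
  rw [add_zero] at ht
  refine ht.congr' ?_
  filter_upwards [self_mem_nhdsWithin] with y hy using (h y hy).symm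

lemma eq_add_cconv_one {F f : ℝ → ℂ} {l : ℂ} (hf : CausalReg f)
    (hF : ∀ y, 0 < y → HasDerivAt F (f y) y) (hl : Tendsto F (𝓝[>] 0) (𝓝 l)) {y : ℝ}
    (hy : 0 < y) : F y = l * rlKernel 1 y + cconv (rlKernel 1) f y := by
  obtain ⟨l', hl', h⟩ := exists_eq_add_cconv_one hf hF
  rw [tendsto_nhds_unique hl hl', rlKernel_one, mul_one, h y hy]

/-- The functions `F 0, …, F m` are successive derivatives on `(0, ∞)`. -/
def DerivChain (F : ℕ → ℝ → ℂ) (m : ℕ) : Prop :=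
  ∀ j < m, ∀ y, 0 < y → HasDerivAt (F j) (F (j + 1) y) y

section DerivChain

variable {F : ℕ → ℝ → ℂ} {m : ℕ}

lemma DerivChain.of_succ (h : DerivChain F (m + 1)) : DerivChain F m :=
  fun j hj => h j (by omega)

lemma causalReg_of_hasDerivAt {F f : ℝ → ℂ} (hf : CausalReg f)
    (hF : ∀ y, 0 < y → HasDerivAt F (f y) y) : CausalReg F := by
  obtain ⟨l, hl, -⟩ := exists_eq_add_cconv_one hf hF
  have h1 := causalReg_rlKernel (p := 1) (by simp)
  exact ((h1.const_mul l).add (h1.cconv hf)).congr fun y hy => eq_add_cconv_one hf hF hl hy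

lemma DerivChain.exists_tendsto (h : DerivChain F m) (hm : CausalReg (F m)) :
    ∃ l : ℕ → ℂ, ∀ j < m, Tendsto (F j) (𝓝[>] 0) (𝓝 (l j)) := by
  induction m with
  | zero => exact ⟨0, fun j hj => by omega⟩
  | succ m ih =>
    obtain ⟨l, hl⟩ := ih h.of_succ (causalReg_of_hasDerivAt hm (h m m.lt_succ_self))
    obtain ⟨l', hl', -⟩ := exists_eq_add_cconv_one hm (h m m.lt_succ_self)
    refine ⟨Function.update l m l', fun j hj => ?_⟩
    rcases Nat.lt_succ_iff_lt_or_eq.1 hj with hj | rfl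
    · rw [Function.update_of_ne hj.ne]; exact hl j hj
    · rwa [Function.update_self]

/-- Transform `F = l + 1 * f`, with `*` the convolution: convergence passes from the derivative to
`F`, without a growth bound on `F`. -/
lemma lapConv_of_hasDerivAt {F f : ℝ → ℂ} {l s : ℂ} (hf : CausalReg f) (hs : 0 < s.re)
    (hfs : LapConv f s) (hF : ∀ y, 0 < y → HasDerivAt F (f y) y)
    (hl : Tendsto F (𝓝[>] 0) (𝓝 l)) : LapConv F s ∧ lap f s = s * lap F s - l := by
  have h1 : LapConv (rlKernel 1) s := lapConv_rlKernel (by simp) hs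
  have h2 := h1.const_mul l
  have h3 := h1.cconv hfs
  have hs0 : s ≠ 0 := by rintro rfl; simp at hs
  refine ⟨(h2.add h3).congr fun y hy => eq_add_cconv_one hf hF hl hy, ?_⟩
  rw [lap_congr fun y hy => eq_add_cconv_one hf hF hl hy, lap_add h2 h3, lap_const_mul,
    lap_cconv h1 hfs, lap_rlKernel (by simp) hs, Complex.cpow_neg_one]
  field_simp
  ring

lemma DerivChain.lap_eq (h : DerivChain F m) (hm : CausalReg (F m)) {s : ℂ} (hs : 0 < s.re)
    (hms : LapConv (F m) s) {l : ℕ → ℂ} (hl : ∀ j < m, Tendsto (F j) (𝓝[>] 0) (𝓝 (l j))) :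
    lap (F m) s = s ^ m * lap (F 0) s - ∑ j ∈ Finset.range m, s ^ (m - 1 - j) * l j := by
  induction m with
  | zero => simp
  | succ m ih =>
    obtain ⟨h1, h2⟩ := lapConv_of_hasDerivAt hm hs hms (h m m.lt_succ_self) (hl m m.lt_succ_self)
    rw [h2, ih h.of_succ (causalReg_of_hasDerivAt hm (h m m.lt_succ_self)) h1
      fun j hj => hl j (by omega), Finset.sum_range_succ]
    simp only [Nat.add_sub_cancel, Nat.sub_self, pow_zero, one_mul]
    rw [mul_sub, Finset.mul_sum, sub_sub, ← mul_assoc, ← pow_succ']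
    congr 2
    refine Finset.sum_congr rfl fun j hj => ?_
    have : m - j = (m - 1 - j) + 1 := by have := Finset.mem_range.1 hj; omega
    rw [this, pow_succ', mul_assoc]

/-- Taylor's formula with both polynomial and remainder written in Riemann-Liouville kernels, so
that a fractional integral merely shifts every order. -/
lemma DerivChain.taylor (h : DerivChain F (m + 1)) (hm : CausalReg (F (m + 1))) {l : ℕ → ℂ}
    (hl : ∀ j < m + 1, Tendsto (F j) (𝓝[>] 0) (𝓝 (l j))) {y : ℝ} (hy : 0 < y) :
    F 0 y = (∑ k ∈ Finset.range (m + 1), l k * rlKernel (k + 1) y) +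
      cconv (rlKernel ((m + 1 : ℕ) : ℂ)) (F (m + 1)) y := by
  induction m generalizing y with
  | zero => simpa using eq_add_cconv_one hm (h 0 one_pos) (hl 0 one_pos) hy
  | succ m ih =>
    have hF := h (m + 1) (by omega)
    have h1 := causalReg_rlKernel (p := 1) (by simp)
    have hm1 := causalReg_rlKernel (p := ((m + 1 : ℕ) : ℂ)) (by simp; positivity)
    rw [ih h.of_succ (causalReg_of_hasDerivAt hm hF) (fun j hj => hl j (by omega)) hy,
      Finset.sum_range_succ _ (m + 1), add_assoc, cconv_comm,
      cconv_congr (fun t ht => eq_add_cconv_one hm hF (hl (m + 1) (by omega)) ht)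
        (fun _ _ => rfl) hy,
      cconv_add_left (h1.const_mul _) (h1.cconv hm) hm1 hy, cconv_const_mul_left,
      cconv_rlKernel_rlKernel (by simp) (by simp; positivity) hy, cconv_comm (cconv _ _),
      cconv_rlKernel_cconv hm (by simp; positivity) (by simp) hy]
    push_cast
    ring_nf

end DerivChain

/-- The derivatives of the fractional integral of order `p` of a function with Taylor coefficients
`l` at `0` and `m`-th derivative `g`. -/
def fracChain (l : ℕ → ℂ) (m : ℕ) (p : ℂ) (g : ℝ → ℂ) (j : ℕ) (y : ℝ) : ℂ :=
  (∑ k ∈ Finset.range m, l k * rlKernel (p - j + k + 1) y) + cconv (rlKernel (p - j + m)) g y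

lemma derivChain_fracChain (l : ℕ → ℂ) (m : ℕ) {p : ℂ} (hp : 0 < p.re) {g : ℝ → ℂ}
    (hg : CausalReg g) : DerivChain (fracChain l m p g) m := by
  intro j hj y hy
  refine HasDerivAt.add ?_ ?_
  · refine HasDerivAt.fun_sum fun k _ => ?_
    convert! (hasDerivAt_rlKernel (p - j + k + 1) hy).const_mul (l k) using 3
    push_cast; ring
  · have hj' : (j : ℝ) + 1 ≤ m := by exact_mod_cast hj
    have := hasDerivAt_cconv_rlKernel hg (p := p - j + m) (by simp; linarith) hy
    refine this.congr_deriv ?_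
    congr 2
    push_cast; ring

lemma DerivChain.cconv_eq_fracChain {F : ℕ → ℝ → ℂ} {m : ℕ} (h : DerivChain F (m + 1))
    (hm : CausalReg (F (m + 1))) {l : ℕ → ℂ}
    (hl : ∀ j < m + 1, Tendsto (F j) (𝓝[>] 0) (𝓝 (l j))) {p : ℂ} (hp : 0 < p.re) {y : ℝ}
    (hy : 0 < y) : cconv (rlKernel p) (F 0) y = fracChain l (m + 1) p (F (m + 1)) 0 y := by
  have hk : ∀ k : ℕ, CausalReg (rlKernel ((k : ℂ) + 1)) := fun k =>
    causalReg_rlKernel (by simp; positivity)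
  have hm1 := causalReg_rlKernel (p := ((m + 1 : ℕ) : ℂ)) (by simp; positivity)
  rw [cconv_comm, cconv_congr (fun t ht => h.taylor hm hl ht) (fun _ _ => rfl) hy,
    cconv_add_left (CausalReg.sum fun k _ => (hk k).const_mul (l k)) (hm1.cconv hm)
      (causalReg_rlKernel hp) hy,
    cconv_sum_left (fun k _ => (hk k).const_mul (l k)) (causalReg_rlKernel hp) hy,
    cconv_comm (cconv _ _), cconv_rlKernel_cconv hm hp (by simp; positivity) hy, fracChain]
  congr 1
  · refine Finset.sum_congr rfl fun k _ => ?_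
    rw [cconv_const_mul_left, cconv_rlKernel_rlKernel (by simp; positivity) hp hy]
    push_cast
    ring_nf
  · push_cast; ring_nf

/-! ### Sums of powers with a limit at `0` -/

lemma tendsto_ofReal_cpow_zero {z : ℂ} (hz : 0 < z.re) :
    Tendsto (fun y : ℝ => (y : ℂ) ^ z) (𝓝[>] 0) (𝓝 0) := by
  rw [tendsto_zero_iff_norm_tendsto_zero]
  have h := (Real.continuousAt_rpow_const 0 z.re (Or.inr hz.le)).tendsto
  rw [Real.zero_rpow hz.ne'] at h
  refine (h.mono_left nhdsWithin_le_nhds).congr' ?_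
  filter_upwards [self_mem_nhdsWithin] with y hy
  rw [Complex.norm_cpow_eq_rpow_re_of_pos hy]

/-- A nonzero imaginary power oscillates: scaling `y` by `exp (π / Im z)` changes its sign, so the
limit is `0`, whereas the modulus is constantly `‖d‖`. -/
lemma eq_zero_of_tendsto_mul_cpow {d z L : ℂ} (hz : z.re = 0) (hz0 : z ≠ 0)
    (h : Tendsto (fun y : ℝ => d * (y : ℂ) ^ z) (𝓝[>] 0) (𝓝 L)) : d = 0 := by
  have him : z.im ≠ 0 := fun h => hz0 (Complex.ext hz h)
  set r := Real.exp (Real.pi / z.im) with hr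
  have hr0 : 0 < r := Real.exp_pos _
  have hrz : (r : ℂ) ^ z = -1 := by
    have him' : (z.im : ℂ) ≠ 0 := by exact_mod_cast him
    have hz' : z = z.im * Complex.I := by
      apply Complex.ext <;> simp [hz]
    rw [Complex.cpow_def_of_ne_zero (by exact_mod_cast hr0.ne'), ← Complex.ofReal_log hr0.le, hr,
      Real.log_exp, ← Complex.exp_pi_mul_I, hz']
    congr 1
    push_cast
    simp only [Complex.mul_im, Complex.ofReal_re, Complex.I_im, mul_one, Complex.ofReal_im,
      Complex.I_re, mul_zero, add_zero]
    field_simp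
  have h1 : Tendsto (fun y : ℝ => r * y) (𝓝[>] 0) (𝓝[>] 0) := by
    refine tendsto_nhdsWithin_iff.2 ⟨?_, ?_⟩
    · have : Tendsto (fun y : ℝ => r * y) (𝓝 0) (𝓝 (r * 0)) :=
        (continuous_const.mul continuous_id).tendsto 0
      rw [mul_zero] at this
      exact this.mono_left nhdsWithin_le_nhds
    · filter_upwards [self_mem_nhdsWithin] with y hy using mul_pos hr0 hy
  have h2 := h.comp h1
  have h3 : Tendsto (fun y : ℝ => d * (y : ℂ) ^ z) (𝓝[>] 0) (𝓝 (-L)) := by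
    refine h2.neg.congr' ?_
    filter_upwards [self_mem_nhdsWithin] with y hy
    simp only [Function.comp_apply]
    rw [Complex.ofReal_mul, Complex.mul_cpow_ofReal_nonneg hr0.le (le_of_lt hy), hrz]
    ring
  have hL : L = 0 := by
    have := tendsto_nhds_unique h h3
    linear_combination this / 2
  have h4 : Tendsto (fun _ : ℝ => ‖d‖) (𝓝[>] 0) (𝓝 0) := by
    rw [hL] at h
    refine (tendsto_zero_iff_norm_tendsto_zero.1 h).congr' ?_
    filter_upwards [self_mem_nhdsWithin] with y hy
    rw [norm_mul, Complex.norm_cpow_eq_rpow_re_of_pos hy, hz, Real.rpow_zero, mul_one]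
  exact norm_eq_zero.1 (tendsto_nhds_unique tendsto_const_nhds h4)

/-- The exponents rise in unit steps, so the first one dominates. If its real part is negative,
multiply by `y ^ (-z)`; if it is zero, all later powers tend to `0` and only oscillation remains.
Subtract the first term, now constant or zero, and induct. -/
lemma powers_of_tendsto {m : ℕ} {d : ℕ → ℂ} {z L : ℂ}
    (h : Tendsto (fun y : ℝ => ∑ k ∈ Finset.range m, d k * (y : ℂ) ^ (z + k)) (𝓝[>] 0) (𝓝 L)) :
    ∀ k < m, d k = 0 ∨ z + k = 0 ∨ 0 < (z + k).re := by
  induction m generalizing d z L with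
  | zero => intro k hk; omega
  | succ m ih =>
    by_cases hz : 0 < z.re
    · intro k _
      right; right
      simp only [Complex.add_re, Complex.natCast_re]; positivity
    have hz : z.re ≤ 0 := not_lt.1 hz
    have hsplit : ∀ y : ℝ, ∑ k ∈ Finset.range (m + 1), d k * (y : ℂ) ^ (z + k) =
        (∑ k ∈ Finset.range m, d (k + 1) * (y : ℂ) ^ (z + 1 + k)) + d 0 * (y : ℂ) ^ z := by
      intro y
      rw [Finset.sum_range_succ']
      push_cast
      rw [add_zero]
      congr 1
      refine Finset.sum_congr rfl fun k _ => ?_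
      ring_nf
    have hfirst : z = 0 ∨ d 0 = 0 := by
      by_contra! hcon
      obtain ⟨hz0, hd0⟩ := hcon
      apply hd0
      rcases hz.lt_or_eq with hlt | heq
      · have h1 := (tendsto_ofReal_cpow_zero (z := -z) (by simpa using hlt)).mul h
        rw [zero_mul] at h1
        have h2 : Tendsto (fun y : ℝ => (∑ k ∈ Finset.range m, d (k + 1) * (y : ℂ) ^ ((k : ℂ) + 1))
            + d 0) (𝓝[>] 0) (𝓝 ((∑ k ∈ Finset.range m, d (k + 1) * 0) + d 0)) := by
          refine Tendsto.add (tendsto_finsetSum _ fun k _ => Tendsto.const_mul _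
            (tendsto_ofReal_cpow_zero ?_)) tendsto_const_nhds
          simp; positivity
        have h3 := tendsto_nhds_unique (h1.congr' ?_) h2
        · simpa using h3.symm
        · filter_upwards [self_mem_nhdsWithin] with y hy
          have hy0 : (y : ℂ) ≠ 0 := by exact_mod_cast (ne_of_gt hy)
          rw [hsplit, mul_add, Finset.mul_sum]
          congr 1
          · refine Finset.sum_congr rfl fun k _ => ?_
            rw [mul_left_comm, ← Complex.cpow_add _ _ hy0]
            ring_nf
          · rw [mul_left_comm, ← Complex.cpow_add _ _ hy0]; simp
      · have h2 : Tendsto (fun y : ℝ => ∑ k ∈ Finset.range m, d (k + 1) * (y : ℂ) ^ (z + 1 + k))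
            (𝓝[>] 0) (𝓝 (∑ k ∈ Finset.range m, d (k + 1) * 0)) := by
          refine tendsto_finsetSum _ fun k _ => Tendsto.const_mul _ (tendsto_ofReal_cpow_zero ?_)
          simp [heq]; positivity
        refine eq_zero_of_tendsto_mul_cpow heq hz0 ((h.sub h2).congr fun y => ?_)
        rw [hsplit]; ring
    have hcst : Tendsto (fun y : ℝ => d 0 * (y : ℂ) ^ z) (𝓝[>] 0) (𝓝 (d 0)) := by
      rcases hfirst with rfl | h0
      · simp
      · simp [h0]
    have hrest := ih (d := fun k => d (k + 1)) (z := z + 1) ((h.sub hcst).congr fun y => by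
      rw [hsplit]; ring)
    intro k hk
    rcases k with _ | k
    · rcases hfirst with h0 | h0
      · right; left; simpa using h0
      · left; exact h0
    · have h1 : z + ((k + 1 : ℕ) : ℂ) = z + 1 + k := by push_cast; ring
      rw [h1]
      exact hrest k (by omega)

lemma rlKernel_terms_of_tendsto {m : ℕ} {l : ℕ → ℂ} {z L : ℂ}
    (h : Tendsto (fun y : ℝ => ∑ k ∈ Finset.range m, l k * rlKernel (z + k + 1) y)
      (𝓝[>] 0) (𝓝 L)) :
    ∀ k < m, (∀ y, l k * rlKernel (z + k) y = 0) ∨ 0 < (z + k).re := by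
  intro k hk
  have h1 := powers_of_tendsto (d := fun k => l k * (Complex.Gamma (z + k + 1))⁻¹) (z := z)
    (h.congr fun y => Finset.sum_congr rfl fun k _ => by
      rw [rlKernel, add_sub_cancel_right, mul_assoc]) k hk
  rcases h1 with h1 | h1 | h1
  · left
    intro y
    rw [rlKernel, Complex.one_div_Gamma_eq_self_mul_one_div_Gamma_add_one]
    linear_combination ((z + k) * (y : ℂ) ^ (z + k - 1)) * h1
  -- The surviving constant term: differentiating kills it, encoded as `1/Γ(0) = 0`.
  · left
    intro y
    rw [h1, rlKernel]; simp
  · right; exact h1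

/-! ### Change of variables -/

/-- Increasing bijections of `(0, ∞)` with positive derivative. -/
structure PhiMap (φ : ℝ → ℝ) : Prop where
  continuousOn : ContinuousOn φ (Ici 0)
  map_zero : φ 0 = 0
  deriv_pos : ∀ x, 0 < x → 0 < deriv φ x
  tendsto : Tendsto φ atTop atTop

/-- The inverse of `φ` on `(0, ∞)`. -/
def phiInv (φ : ℝ → ℝ) : ℝ → ℝ := Function.invFunOn φ (Ioi 0)

namespace PhiMap

variable {φ : ℝ → ℝ}

lemma strictMonoOn (h : PhiMap φ) : StrictMonoOn φ (Ici 0) :=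
  strictMonoOn_of_deriv_pos (convex_Ici 0) h.continuousOn fun x hx => by
    rw [interior_Ici] at hx; exact h.deriv_pos x hx

lemma pos (h : PhiMap φ) {x : ℝ} (hx : 0 < x) : 0 < φ x := by
  have := h.strictMonoOn (mem_Ici.2 le_rfl) (mem_Ici.2 hx.le) hx
  rwa [h.map_zero] at this

lemma lt_of_lt (h : PhiMap φ) {x z : ℝ} (hx : 0 < x) (hxz : x < z) : φ x < φ z :=
  h.strictMonoOn (mem_Ici.2 hx.le) (mem_Ici.2 (hx.trans hxz).le) hxz

lemma exists_eq (h : PhiMap φ) {y : ℝ} (hy : 0 < y) : ∃ x, 0 < x ∧ φ x = y := by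
  obtain ⟨X, hX0, hX⟩ : ∃ X, 0 < X ∧ y < φ X :=
    ((eventually_gt_atTop 0).and (h.tendsto.eventually_gt_atTop y)).exists
  have := intermediate_value_Ioo hX0.le (h.continuousOn.mono Icc_subset_Ici_self)
  obtain ⟨x, hx, rfl⟩ := this ⟨by rwa [h.map_zero], hX⟩
  exact ⟨x, hx.1, rfl⟩

lemma inv_pos (h : PhiMap φ) {y : ℝ} (hy : 0 < y) : 0 < phiInv φ y := by
  obtain ⟨x, hx, rfl⟩ := h.exists_eq hy
  exact Function.invFunOn_mem ⟨x, hx, rfl⟩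

lemma apply_inv (h : PhiMap φ) {y : ℝ} (hy : 0 < y) : φ (phiInv φ y) = y := by
  obtain ⟨x, hx, rfl⟩ := h.exists_eq hy
  exact Function.invFunOn_eq ⟨x, hx, rfl⟩

lemma inv_apply (h : PhiMap φ) {x : ℝ} (hx : 0 < x) : phiInv φ (φ x) = x :=
  h.strictMonoOn.injOn (mem_Ici.2 (h.inv_pos (h.pos hx)).le) (mem_Ici.2 hx.le)
    (h.apply_inv (h.pos hx))

lemma lt_inv_iff (h : PhiMap φ) {x y : ℝ} (hx : 0 < x) (hy : 0 < y) : x < phiInv φ y ↔ φ x < y := by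
  rw [← h.strictMonoOn.lt_iff_lt (mem_Ici.2 hx.le) (mem_Ici.2 (h.inv_pos hy).le), h.apply_inv hy]

lemma inv_lt_iff (h : PhiMap φ) {x y : ℝ} (hx : 0 < x) (hy : 0 < y) : phiInv φ y < x ↔ y < φ x := by
  rw [← h.strictMonoOn.lt_iff_lt (mem_Ici.2 (h.inv_pos hy).le) (mem_Ici.2 hx.le), h.apply_inv hy]

lemma hasDerivAt (h : PhiMap φ) {x : ℝ} (hx : 0 < x) : HasDerivAt φ (deriv φ x) x :=
  (differentiableAt_of_deriv_ne_zero (h.deriv_pos x hx).ne').hasDerivAt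

lemma image_Ioi (h : PhiMap φ) : φ '' Ioi 0 = Ioi 0 := by
  ext y
  constructor
  · rintro ⟨x, hx, rfl⟩; exact h.pos hx
  · intro hy; exact ⟨_, h.inv_pos hy, h.apply_inv hy⟩

lemma image_Ioo (h : PhiMap φ) {x : ℝ} (hx : 0 < x) : φ '' Ioo 0 x = Ioo 0 (φ x) := by
  ext y
  constructor
  · rintro ⟨t, ht, rfl⟩; exact ⟨h.pos ht.1, h.lt_of_lt ht.1 ht.2⟩
  · intro hy
    exact ⟨_, ⟨h.inv_pos hy.1, (h.inv_lt_iff hx hy.1).2 hy.2⟩, h.apply_inv hy.1⟩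

lemma continuousAt_inv (h : PhiMap φ) {y : ℝ} (hy : 0 < y) : ContinuousAt (phiInv φ) y := by
  refine StrictMonoOn.continuousAt_of_image_mem_nhds (s := Ioi 0) ?_ (Ioi_mem_nhds hy) ?_
  · intro a ha b hb hab
    rw [h.lt_inv_iff (h.inv_pos ha) hb, h.apply_inv ha]; exact hab
  · have : phiInv φ '' Ioi 0 = Ioi 0 := by
      ext x
      constructor
      · rintro ⟨y, hy, rfl⟩; exact h.inv_pos hy
      · intro hx; exact ⟨φ x, h.pos hx, h.inv_apply hx⟩
    rw [this]
    exact Ioi_mem_nhds (h.inv_pos hy)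

lemma hasDerivAt_inv (h : PhiMap φ) {y : ℝ} (hy : 0 < y) :
    HasDerivAt (phiInv φ) (deriv φ (phiInv φ y))⁻¹ y := by
  refine HasDerivAt.of_local_left_inverse (h.continuousAt_inv hy) (h.hasDerivAt (h.inv_pos hy))
    (h.deriv_pos _ (h.inv_pos hy)).ne' ?_
  filter_upwards [Ioi_mem_nhds hy] with z hz using h.apply_inv hz

lemma tendsto_zero (h : PhiMap φ) : Tendsto φ (𝓝[>] 0) (𝓝[>] 0) := by
  refine tendsto_nhdsWithin_iff.2 ⟨?_, ?_⟩
  · have := (h.continuousOn 0 (mem_Ici.2 le_rfl)).mono_left (nhdsWithin_mono 0 Ioi_subset_Ici_self)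
    rwa [h.map_zero] at this
  · filter_upwards [self_mem_nhdsWithin] with x hx using h.pos hx

lemma tendsto_inv_zero (h : PhiMap φ) : Tendsto (phiInv φ) (𝓝[>] 0) (𝓝[>] 0) := by
  refine ((nhdsGT_basis (0 : ℝ)).tendsto_iff (nhdsGT_basis (0 : ℝ))).2 fun x hx => ?_
  exact ⟨φ x, h.pos hx, fun y hy => ⟨h.inv_pos hy.1, (h.inv_lt_iff hx hy.1).2 hy.2⟩⟩

lemma continuousOn_comp_inv (h : PhiMap φ) {f : ℝ → ℂ} (hf : ContinuousOn f (Ioi 0)) :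
    ContinuousOn (f ∘ phiInv φ) (Ioi 0) :=
  hf.comp (fun _ hy => (h.continuousAt_inv hy).continuousWithinAt) fun _ hy => h.inv_pos hy

lemma injOn_Ioi (h : PhiMap φ) : InjOn φ (Ioi 0) := h.strictMonoOn.injOn.mono Ioi_subset_Ici_self

lemma causalReg_comp_inv (h : PhiMap φ) {u : ℝ → ℂ} (hu : ContinuousOn u (Ioi 0))
    (hint : ∀ T : ℝ, 0 < T → IntegrableOn (fun t => ((deriv φ t : ℝ) : ℂ) * u t) (Ioc 0 T)) :
    CausalReg (u ∘ phiInv φ) := by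
  refine ⟨h.continuousOn_comp_inv hu, fun T => ?_⟩
  rcases le_or_gt T 0 with hT | hT
  · simp [Ioc_eq_empty_of_le hT]
  have hx := h.inv_pos hT
  rw [integrableOn_Ioc_iff_integrableOn_Ioo, ← h.apply_inv hT, ← h.image_Ioo hx,
    integrableOn_image_iff_integrableOn_abs_deriv_smul measurableSet_Ioo
      (fun x hx => (h.hasDerivAt hx.1).hasDerivWithinAt)
      (h.injOn_Ioi.mono Ioo_subset_Ioi_self)]
  refine ((hint _ hx).mono_set Ioo_subset_Ioc_self).congr_fun (fun t ht => ?_) measurableSet_Ioo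
  simp only [Function.comp_apply]
  rw [h.inv_apply ht.1, abs_of_pos (h.deriv_pos t ht.1), Complex.real_smul]

lemma integral_eq_cconv (h : PhiMap φ) (k u : ℝ → ℂ) {x : ℝ} (hx : 0 < x) :
    ∫ t in (0 : ℝ)..x, ((deriv φ t : ℝ) : ℂ) * (k (φ x - φ t) * u t) =
      cconv k (u ∘ phiInv φ) (φ x) := by
  rw [cconv, intervalIntegral.integral_of_le hx.le, intervalIntegral.integral_of_le (h.pos hx).le,
    integral_Ioc_eq_integral_Ioo, integral_Ioc_eq_integral_Ioo, ← h.image_Ioo hx,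
    integral_image_eq_integral_abs_deriv_smul measurableSet_Ioo
      (fun x hx => (h.hasDerivAt hx.1).hasDerivWithinAt)
      (h.injOn_Ioi.mono Ioo_subset_Ioi_self)]
  refine setIntegral_congr_fun measurableSet_Ioo fun t ht => ?_
  simp only [Function.comp_apply]
  rw [h.inv_apply ht.1, abs_of_pos (h.deriv_pos t ht.1), Complex.real_smul]

lemma rlIntegral_eq (h : PhiMap φ) (μ : ℂ) (u : ℝ → ℂ) {x : ℝ} (hx : 0 < x) :
    rlIntegral φ μ u x = cconv (rlKernel μ) (u ∘ phiInv φ) (φ x) := by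
  rw [← h.integral_eq_cconv _ _ hx, rlIntegral, ← intervalIntegral.integral_const_mul]
  congr 1; ext t
  rw [rlKernel]; ring

lemma genIntegral_eq (h : PhiMap φ) (a : ℕ → ℂ) (μ β : ℂ) (u : ℝ → ℂ) {x : ℝ} (hx : 0 < x) :
    genIntegral φ a μ β u x =
      cconv (fun r : ℝ => (r : ℂ) ^ (μ - 1) * kernelFun a ((r : ℂ) ^ β)) (u ∘ phiInv φ) (φ x) := by
  rw [← h.integral_eq_cconv _ _ hx, genIntegral]
  congr 1; ext t
  ring

lemma lapConv_iff (h : PhiMap φ) (f : ℝ → ℂ) (s : ℂ) :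
    PhiLaplaceConvergent φ f s ↔ LapConv (f ∘ phiInv φ) s := by
  rw [LapConv]
  nth_rw 1 [← h.image_Ioi]
  rw [integrableOn_image_iff_integrableOn_abs_deriv_smul measurableSet_Ioi
      (fun x hx => (h.hasDerivAt hx).hasDerivWithinAt) h.injOn_Ioi, PhiLaplaceConvergent]
  refine integrableOn_congr_fun (fun t ht => ?_) measurableSet_Ioi
  simp only [Function.comp_apply]
  rw [h.inv_apply ht, abs_of_pos (h.deriv_pos t ht), Complex.real_smul, phiLaplaceIntegrand]
  ring

lemma phiLaplace_eq (h : PhiMap φ) (f : ℝ → ℂ) (s : ℂ) : phiLaplace φ f s = lap (f ∘ phiInv φ) s := by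
  rw [lap]
  nth_rw 1 [← h.image_Ioi]
  rw [integral_image_eq_integral_abs_deriv_smul measurableSet_Ioi
      (fun x hx => (h.hasDerivAt hx).hasDerivWithinAt) h.injOn_Ioi, phiLaplace]
  refine setIntegral_congr_fun measurableSet_Ioi fun t ht => ?_
  simp only [Function.comp_apply]
  rw [h.inv_apply ht, abs_of_pos (h.deriv_pos t ht), Complex.real_smul, phiLaplaceIntegrand]
  ring

lemma exists_lapConv (h : PhiMap φ) {f : ℝ → ℂ} (hf : CausalReg (f ∘ phiInv φ)) (he : PhiExpOrder φ f) :
    ∃ c : ℝ, ∀ s : ℂ, c < s.re → LapConv (f ∘ phiInv φ) s := by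
  obtain ⟨c, M, X, -, -, hX, hb⟩ := he
  refine ⟨c, hf.exists_lapConv (M := M) (X := φ X) fun y hy => ?_⟩
  have hy0 : 0 < y := (h.pos hX).trans hy
  have := hb _ ((h.lt_inv_iff hX hy0).2 hy)
  rwa [h.apply_inv hy0] at this

/-- By the chain rule, `φ` conjugates `D_φ` to `d/dy`; iterates are computed on a chain since only
values on `(0, ∞)` matter. -/
lemma phiDeriv_iterate_eq (h : PhiMap φ) {F : ℕ → ℝ → ℂ} {m : ℕ} (hF : DerivChain F m) {f : ℝ → ℂ}
    (hf : ∀ x, 0 < x → f x = F 0 (φ x)) :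
    ∀ j ≤ m, ∀ x, 0 < x → (phiDeriv φ)^[j] f x = F j (φ x) := by
  intro j
  induction j with
  | zero => exact fun _ => hf
  | succ j ih =>
    intro hj x hx
    have h1 : (phiDeriv φ)^[j] f =ᶠ[𝓝 x] fun x => F j (φ x) := by
      filter_upwards [Ioi_mem_nhds hx] with t ht using ih (by omega) t ht
    have h2 := (hF j hj (φ x) (h.pos hx)).scomp x (h.hasDerivAt hx)
    have h3 : ((deriv φ x : ℝ) : ℂ) ≠ 0 := by exact_mod_cast (h.deriv_pos x hx).ne'
    rw [Function.iterate_succ_apply', phiDeriv, h1.deriv_eq]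
    rw [show deriv (fun x => F j (φ x)) x = _ from h2.deriv, Complex.real_smul,
      inv_mul_cancel_left₀ h3]

lemma differentiableOn_phiDeriv_iterate (h : PhiMap φ) {F : ℕ → ℝ → ℂ} {m : ℕ} (hF : DerivChain F m) {f : ℝ → ℂ}
    (hf : ∀ x, 0 < x → f x = F 0 (φ x)) {j : ℕ} (hj : j < m) :
    DifferentiableOn ℝ ((phiDeriv φ)^[j] f) (Ioi 0) := by
  intro x hx
  have h2 := (hF j hj (φ x) (h.pos hx)).scomp x (h.hasDerivAt hx)
  refine (DifferentiableAt.congr_of_eventuallyEq h2.differentiableAt ?_).differentiableWithinAt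
  filter_upwards [Ioi_mem_nhds hx] with t ht
  exact h.phiDeriv_iterate_eq hF hf j hj.le t ht

lemma derivChain_comp_inv (h : PhiMap φ) {f : ℝ → ℂ} {m : ℕ}
    (hd : ∀ k < m, DifferentiableOn ℝ ((phiDeriv φ)^[k] f) (Ioi 0)) :
    DerivChain (fun j => (phiDeriv φ)^[j] f ∘ phiInv φ) m := by
  intro j hj y hy
  have hx := h.inv_pos hy
  have h1 := ((hd j hj).differentiableAt (Ioi_mem_nhds hx)).hasDerivAt
  refine (h1.scomp y (h.hasDerivAt_inv hy)).congr_deriv ?_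
  simp only [Function.comp_apply, Function.iterate_succ_apply', phiDeriv]
  rw [Complex.real_smul, Complex.ofReal_inv]

lemma tendsto_comp_iff (h : PhiMap φ) {f : ℝ → ℂ} {l : ℂ} :
    Tendsto (f ∘ phiInv φ) (𝓝[>] 0) (𝓝 l) ↔ Tendsto f (𝓝[>] 0) (𝓝 l) := by
  refine ⟨fun hf => (hf.comp h.tendsto_zero).congr' ?_, fun hf => hf.comp h.tendsto_inv_zero⟩
  filter_upwards [self_mem_nhdsWithin] with x hx
  simp only [Function.comp_apply]
  rw [h.inv_apply hx]

end PhiMap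

/-! ### Continuation of the transform identity along rays -/

/-- A positive factor does not change the argument, so the principal power is multiplicative along
rays. -/
lemma exp_mul_cpow {s : ℂ} (hs : s ≠ 0) (x : ℝ) (z : ℂ) :
    (Complex.exp x * s) ^ z = Complex.exp (x * z) * s ^ z := by
  rw [Complex.cpow_def_of_ne_zero (mul_ne_zero (Complex.exp_ne_zero _) hs),
    Complex.cpow_def_of_ne_zero hs, ← Complex.exp_add, ← Complex.ofReal_exp,
    Complex.log_ofReal_mul (Real.exp_pos x) hs, Real.log_exp]
  ring_nf

lemma re_exp_mul (x : ℝ) (s : ℂ) : (Complex.exp x * s).re = Real.exp x * s.re := by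
  rw [← Complex.ofReal_exp, Complex.re_ofReal_mul]

/-- Along `eˣ s₀` the series is `e^{xα}` times a power series in `e^{-xβ}`, and `‖e^{-xβ}‖ ≤ 1` for
`x ≥ 0`. Absolute convergence at `s₀` thus propagates outward. For complex `β` the modulus of
`s^{-βn}` depends on `arg s`, which is why a ray is used and not a half-plane. -/
lemma lap_eq_of_eventually {f g : ℝ → ℂ} {s₀ α β : ℂ} (hs₀ : 0 < s₀.re) (hβ : 0 < β.re)
    (hf : LapConv f s₀) (hg : LapConv g s₀) {c : ℕ → ℂ}
    (hc : Summable fun n : ℕ => c n * s₀ ^ (α - β * n)) {Z : ℂ → ℂ} (hZ : Differentiable ℂ Z)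
    {σ : ℝ} (h : ∀ s : ℂ, σ < s.re →
      lap f s = (∑' n : ℕ, c n * s ^ (α - β * n)) * lap g s - Z s) :
    lap f s₀ = (∑' n : ℕ, c n * s₀ ^ (α - β * n)) * lap g s₀ - Z s₀ := by
  have hs0 : s₀ ≠ 0 := by rintro rfl; simp at hs₀
  set d : ℕ → ℂ := fun n => c n * s₀ ^ (α - β * n) with hd
  set P : ℂ → ℂ := fun z => ∑' n, d n * z ^ n with hP
  have hPd : DifferentiableOn ℂ P (Metric.ball 0 1) := by
    refine Complex.differentiableOn_tsum_of_summable_norm hc.norm (fun n => by fun_prop)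
      Metric.isOpen_ball fun n z hz => ?_
    rw [norm_mul, norm_pow]
    exact mul_le_of_le_one_right (norm_nonneg _)
      (pow_le_one₀ (norm_nonneg _) (mem_ball_zero_iff.1 hz).le)
  have hPc : ContinuousOn P (Metric.closedBall 0 1) := by
    refine continuousOn_tsum (fun n => by fun_prop) hc.norm fun n z hz => ?_
    rw [norm_mul, norm_pow]
    exact mul_le_of_le_one_right (norm_nonneg _)
      (pow_le_one₀ (norm_nonneg _) (mem_closedBall_zero_iff.1 hz))
  -- The defect of the identity, as a function of a complex parameter along the ray.
  set H : ℂ → ℂ := fun x => lap f (Complex.exp x * s₀) -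
    Complex.exp (x * α) * P (Complex.exp (-x * β)) * lap g (Complex.exp x * s₀) +
      Z (Complex.exp x * s₀) with hH
  have hser : ∀ x : ℝ, ∑' n : ℕ, c n * (Complex.exp x * s₀) ^ (α - β * n) =
      Complex.exp (x * α) * P (Complex.exp (-x * β)) := by
    intro x
    rw [hP, ← tsum_mul_left]
    refine tsum_congr fun n => ?_
    rw [exp_mul_cpow hs0, hd, ← Complex.exp_nat_mul]
    have : Complex.exp (x * (α - β * n)) =
        Complex.exp (x * α) * Complex.exp (n * (-x * β)) := by
      rw [← Complex.exp_add]; ring_nf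
    rw [this]; ring
  have hnorm : ∀ x : ℝ, ‖Complex.exp (-(x : ℂ) * β)‖ = Real.exp (-(x * β.re)) := by
    intro x; rw [Complex.norm_exp]; simp
  have hzero : ∀ x : ℝ, σ < Real.exp x * s₀.re → H x = 0 := by
    intro x hx
    rw [← re_exp_mul] at hx
    rw [hH]
    simp only
    rw [h _ hx, hser]; ring
  set U : Set ℂ := {x | s₀.re < (Complex.exp x * s₀).re} ∩
    {x | Complex.exp (-x * β) ∈ Metric.ball (0 : ℂ) 1} with hU
  have hUo : IsOpen U := by
    refine IsOpen.inter (isOpen_lt continuous_const (by fun_prop)) ?_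
    exact Metric.isOpen_ball.preimage (by fun_prop : Continuous fun x : ℂ => Complex.exp (-x * β))
  have hHd : DifferentiableOn ℂ H U := by
    have hsub : MapsTo (fun x => Complex.exp x * s₀) U {z | s₀.re < z.re} := fun x hx => hx.1
    have he : DifferentiableOn ℂ (fun x => Complex.exp x * s₀) U := by fun_prop
    refine (((differentiableOn_lap hf).comp he hsub).sub (DifferentiableOn.mul
      (DifferentiableOn.mul (by fun_prop) ?_) ((differentiableOn_lap hg).comp he hsub))).add
      (hZ.comp_differentiableOn he)
    exact hPd.comp (by fun_prop : DifferentiableOn ℂ (fun x : ℂ => Complex.exp (-x * β)) U)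
      fun x hx => hx.2
  have hmem : ∀ x : ℝ, 0 < x → (x : ℂ) ∈ U := by
    intro x hx
    constructor
    · simp only [mem_ofPred_eq]
      rw [re_exp_mul]
      have := Real.one_lt_exp_iff.2 hx
      nlinarith
    · simp only [mem_ofPred_eq]
      rw [mem_ball_zero_iff, hnorm, Real.exp_lt_one_iff]
      have := mul_pos hx hβ
      linarith
  -- Restricting to the real axis lets the identity theorem run on an interval, so `U` need not be
  -- shown connected.
  have han : AnalyticOnNhd ℝ (fun x : ℝ => H x) (Ioi 0) := by
    intro x hx
    have h1 := ((hHd.analyticOnNhd hUo) x (hmem x hx)).restrictScalars (𝕜 := ℝ)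
    exact AnalyticAt.comp (f := fun x : ℝ => (x : ℂ)) h1 (Complex.ofRealCLM.analyticAt x)
  obtain ⟨X, hX0, hX⟩ : ∃ X : ℝ, 0 < X ∧ ∀ x, X < x → H x = 0 := by
    have ht : Tendsto (fun x : ℝ => Real.exp x * s₀.re) atTop atTop :=
      Real.tendsto_exp_atTop.atTop_mul_const hs₀
    obtain ⟨X, hX⟩ := eventually_atTop.1 (ht.eventually_gt_atTop σ)
    exact ⟨max X 1, by positivity, fun x hx => hzero x (hX x ((le_max_left _ _).trans hx.le))⟩
  have hpos : EqOn (fun x : ℝ => H x) 0 (Ioi 0) := by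
    refine han.eqOn_zero_of_preconnected_of_eventuallyEq_zero (convex_Ioi (0 : ℝ)).isPreconnected
      (z₀ := X + 1) (mem_Ioi.2 (by linarith)) ?_
    filter_upwards [Ioi_mem_nhds (lt_add_one X)] with x hx using hX x hx
  have hcont : ContinuousOn (fun x : ℝ => H x) (Ici 0) := by
    have hsub : MapsTo (fun x : ℝ => Complex.exp x * s₀) (Ici 0) {z | s₀.re ≤ z.re} := by
      intro x hx
      simp only [mem_ofPred_eq]
      rw [re_exp_mul]
      have := Real.one_le_exp hx
      nlinarith
    have he : ContinuousOn (fun x : ℝ => Complex.exp x * s₀) (Ici 0) := by fun_prop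
    refine (((continuousOn_lap hf).comp he hsub).sub (ContinuousOn.mul
      (ContinuousOn.mul (by fun_prop) ?_) ((continuousOn_lap hg).comp he hsub))).add
      (hZ.continuous.comp_continuousOn he)
    refine hPc.comp (by fun_prop : ContinuousOn (fun x : ℝ => Complex.exp (-(x : ℂ) * β)) (Ici 0))
      fun x hx => ?_
    rw [mem_closedBall_zero_iff, hnorm, Real.exp_le_one_iff]
    have := mul_nonneg (mem_Ici.1 hx) hβ.le
    linarith
  -- The endpoint `s₀` is only a boundary point of analyticity; it is reached by continuity.
  have h0 : H ((0 : ℝ) : ℂ) = 0 := by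
    have h1 := (hcont 0 (mem_Ici.2 le_rfl)).mono_left (nhdsWithin_mono 0 Ioi_subset_Ici_self)
    refine tendsto_nhds_unique h1 (tendsto_const_nhds.congr' ?_)
    filter_upwards [self_mem_nhdsWithin] with x hx using (hpos hx).symm
  have h2 := hser 0
  simp only [hH, Complex.ofReal_zero, Complex.exp_zero, one_mul, zero_mul, neg_zero] at h0 h2
  rw [h2]
  linear_combination h0

/-! ### Derivatives of generalised fractional integrals -/

lemma causalReg_of_tendsto {f : ℝ → ℂ} {l : ℂ} (hf : ContinuousOn f (Ioi 0))
    (hl : Tendsto f (𝓝[>] 0) (𝓝 l)) : CausalReg f := by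
  refine ⟨hf, fun T => ?_⟩
  have hc : ContinuousOn (Function.update f 0 l) (Icc 0 T) := by
    intro x hx
    rcases hx.1.eq_or_lt with rfl | h0
    · rw [continuousWithinAt_update_same]
      refine hl.mono_left (nhdsWithin_mono 0 ?_)
      exact fun y hy => lt_of_le_of_ne hy.1.1 (Ne.symm hy.2)
    · refine ContinuousAt.continuousWithinAt ?_
      rw [continuousAt_update_of_ne h0.ne']
      exact hf.continuousAt (Ioi_mem_nhds h0)
  refine (hc.integrableOn_Icc.mono_set Ioc_subset_Icc_self).congr_fun (fun y hy => ?_)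
    measurableSet_Ioc
  rw [Function.update_of_ne hy.1.ne']

lemma DerivChain.eq_of_eq {F F' : ℕ → ℝ → ℂ} {m m' : ℕ} (h : DerivChain F m)
    (h' : DerivChain F' m') (h0 : ∀ y, 0 < y → F 0 y = F' 0 y) :
    ∀ j ≤ m, j ≤ m' → ∀ y, 0 < y → F j y = F' j y := by
  intro j
  induction j with
  | zero => exact fun _ _ => h0
  | succ j ih =>
    intro hj hj' y hy
    refine (h j hj y hy).unique ((h' j hj' y hy).congr_of_eventuallyEq ?_)
    filter_upwards [Ioi_mem_nhds hy] with x hx using ih (by omega) (by omega) x hx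

lemma DerivChain.shift {F : ℕ → ℝ → ℂ} {m : ℕ} (h : DerivChain F m) (k : ℕ) :
    DerivChain (fun j => F (j + k)) (m - k) := by
  intro j hj y hy
  have := h (j + k) (by omega) y hy
  rwa [add_right_comm] at this

lemma derivChain_cconv_rlKernel {v : ℝ → ℂ} (hv : CausalReg v) {p : ℂ} {j : ℕ}
    (hp : 0 < (p - j).re) : DerivChain (fun k => cconv (rlKernel (p - k)) v) j := by
  intro k hk y hy
  have hk' : (k : ℝ) + 1 ≤ j := by exact_mod_cast hk
  have h1 : p - ((k + 1 : ℕ) : ℂ) = p - k - 1 := by push_cast; ring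
  simp only [h1]
  refine hasDerivAt_cconv_rlKernel hv ?_ hy
  simp only [Complex.sub_re, Complex.natCast_re, Complex.one_re] at hp ⊢
  linarith

lemma DerivChain.eq_cconv {F : ℕ → ℝ → ℂ} {m : ℕ} (hF : DerivChain F m) {v : ℝ → ℂ}
    (hv : CausalReg v) {p : ℂ} (h0 : ∀ y, 0 < y → F 0 y = cconv (rlKernel p) v y) {j : ℕ}
    (hj : j ≤ m) (hp : 0 < (p - j).re) {y : ℝ} (hy : 0 < y) :
    F j y = cconv (rlKernel (p - j)) v y :=
  hF.eq_of_eq (derivChain_cconv_rlKernel hv hp) (fun y hy => by simpa using h0 y hy) j hj le_rfl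
    y hy

/-- When `Re (p - j) ≤ 0`, the definition applies `k ≤ j` derivatives to the integral of order `p -
(j - k)`. That integral is already the derivative of order `j - k` in the chain, so both conventions
give `F j`. -/
lemma PhiMap.rlDifferintegral_eq {φ : ℝ → ℝ} (h : PhiMap φ) {u : ℝ → ℂ}
    (hv : CausalReg (u ∘ phiInv φ)) {F : ℕ → ℝ → ℂ} {m : ℕ} (hF : DerivChain F m) {p : ℂ}
    (hp : 0 < p.re) (h0 : ∀ y, 0 < y → F 0 y = cconv (rlKernel p) (u ∘ phiInv φ) y) {j : ℕ}
    (hj : j ≤ m) {x : ℝ} (hx : 0 < x) : rlDifferintegral φ (p - j) u x = F j (φ x) := by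
  rw [rlDifferintegral]
  split_ifs with hq
  · rw [h.rlIntegral_eq _ _ hx, hF.eq_cconv hv h0 hj hq (h.pos hx)]
  · have hq' : p.re - j ≤ 0 := by simpa using hq
    rw [rlDerivative]
    set k := ⌊(-(p - (j : ℂ))).re⌋₊ + 1 with hk
    have hre : (-(p - (j : ℂ))).re = j - p.re := by simp
    have hkj : k ≤ j := by
      rw [hk, Nat.add_one_le_iff, Nat.floor_lt (by rw [hre]; linarith), hre]
      linarith
    have hk1 : j - p.re < k := by
      rw [hk, ← hre]; push_cast; exact Nat.lt_floor_add_one _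
    have he : (k : ℂ) - -(p - j) = p - ((j - k : ℕ) : ℂ) := by
      rw [Nat.cast_sub hkj]; ring
    have hpos : 0 < (p - ((j - k : ℕ) : ℂ)).re := by
      rw [Nat.cast_sub hkj]
      simp only [Complex.sub_re, Complex.natCast_re]
      linarith
    rw [he, h.phiDeriv_iterate_eq (hF.shift (j - k)) (fun x hx => ?_) k (by omega) x hx]
    · congr 1; omega
    · rw [h.rlIntegral_eq _ _ hx, zero_add, hF.eq_cconv hv h0 (by omega) hpos (h.pos hx)]

/-- The remainder of the penultimate member tends to `0`, so its power sum has a limit. Hence after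
one more derivative each power is either zero or of order with positive real part. -/
lemma fracChain_last {l : ℕ → ℂ} {m : ℕ} {p L : ℂ} (hp : 0 < p.re) {g : ℝ → ℂ} (hg : CausalReg g)
    (h : Tendsto (fracChain l (m + 1) p g m) (𝓝[>] 0) (𝓝 L)) :
    CausalReg (fracChain l (m + 1) p g (m + 1)) ∧
      ∀ s : ℂ, 0 < s.re → LapConv g s → LapConv (fracChain l (m + 1) p g (m + 1)) s := by
  have h1 := tendsto_cconv_rlKernel_zero hg (p := p - m + (m + 1 : ℕ)) (by simp; linarith)
  have h2 := rlKernel_terms_of_tendsto (m := m + 1) (l := l) (z := p - m)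
    ((h.sub h1).congr fun y => by rw [fracChain]; ring)
  have hcast : ∀ k : ℕ, p - ((m + 1 : ℕ) : ℂ) + k + 1 = p - m + k := fun k => by push_cast; ring
  have hcast' : p - ((m + 1 : ℕ) : ℂ) + ((m + 1 : ℕ) : ℂ) = p := by ring
  have hfun : fracChain l (m + 1) p g (m + 1) = fun y =>
      (∑ k ∈ Finset.range (m + 1), l k * rlKernel (p - m + k) y) + cconv (rlKernel p) g y := by
    ext y
    simp only [fracChain, hcast, hcast']
  rw [hfun]
  constructor
  · refine (CausalReg.sum fun k hk => ?_).add ((causalReg_rlKernel hp).cconv hg)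
    rcases h2 k (Finset.mem_range.1 hk) with h3 | h3
    · exact (causalReg_rlKernel (p := 1) (by simp)).const_mul 0 |>.congr fun y _ => by simp [h3 y]
    · exact (causalReg_rlKernel h3).const_mul _
  · intro s hs hgs
    refine (LapConv.sum fun k hk => ?_).add ((lapConv_rlKernel hp hs).cconv hgs)
    rcases h2 k (Finset.mem_range.1 hk) with h3 | h3
    · exact (lapConv_rlKernel (p := 1) (by simp) hs).const_mul 0 |>.congr
        fun y _ => by simp [h3 y]
    · exact (lapConv_rlKernel h3 hs).const_mul _

/-- For `j < m - 1 - N` the order `p - j` has real part at least `1`, so the corresponding initial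
value is `0` and exactly the last `N + 1` can remain. -/
lemma DerivChain.lap_eq_of_cconv {F : ℕ → ℝ → ℂ} {m N : ℕ} (hF : DerivChain F m)
    (hm : CausalReg (F m)) {v : ℝ → ℂ} (hv : CausalReg v) {p : ℂ} (hp : 0 < p.re)
    (h0 : ∀ y, 0 < y → F 0 y = cconv (rlKernel p) v y) (hN : N < m) (hNp : (m : ℝ) - N ≤ p.re + 1)
    {s : ℂ} (hs : 0 < s.re) (hms : LapConv (F m) s) (hvs : LapConv v s) {l : ℕ → ℂ}
    (hl : ∀ i ≤ N, Tendsto (F (m - 1 - N + i)) (𝓝[>] 0) (𝓝 (l i))) :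
    lap (F m) s = s ^ ((m : ℂ) - p) * lap v s - ∑ i ∈ Finset.range (N + 1), s ^ (N - i) * l i := by
  have hs0 : s ≠ 0 := by rintro rfl; simp at hs
  obtain ⟨l', hl'⟩ := hF.exists_tendsto hm
  have hzero : ∀ j < m - 1 - N, l' j = 0 := by
    intro j hj
    have hj' : (j : ℝ) + 1 + N + 1 ≤ m := by
      have : j + 1 + N + 1 ≤ m := by omega
      exact_mod_cast this
    have hpj : 1 ≤ (p - j).re := by
      simp only [Complex.sub_re, Complex.natCast_re]; linarith
    refine tendsto_nhds_unique (hl' j (by omega)) ((tendsto_cconv_rlKernel_zero hv hpj).congr' ?_)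
    filter_upwards [self_mem_nhdsWithin] with y hy
    exact (hF.eq_cconv hv h0 (by omega) (by linarith) hy).symm
  have hlast : ∀ i ≤ N, l' (m - 1 - N + i) = l i := fun i hi =>
    tendsto_nhds_unique (hl' _ (by omega)) (hl i hi)
  have hsum : ∑ j ∈ Finset.range m, s ^ (m - 1 - j) * l' j =
      ∑ i ∈ Finset.range (N + 1), s ^ (N - i) * l i := by
    have hsplit : m = (m - 1 - N) + (N + 1) := by omega
    have h1 := Finset.sum_range_add (fun j => s ^ (m - 1 - j) * l' j) (m - 1 - N) (N + 1)
    rw [← hsplit] at h1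
    rw [h1, Finset.sum_eq_zero fun j hj => by rw [hzero j (Finset.mem_range.1 hj), mul_zero],
      zero_add]
    refine Finset.sum_congr rfl fun i hi => ?_
    have hi := Finset.mem_range.1 hi
    rw [hlast i (by omega)]
    congr 2; omega
  rw [hF.lap_eq hm hs hms hl', hsum, lap_congr h0, lap_cconv (lapConv_rlKernel hp hs) hvs,
    lap_rlKernel hp hs, sub_eq_add_neg (m : ℂ), Complex.cpow_add _ _ hs0, Complex.cpow_natCast]
  ring

/-- The successive derivatives of the fractional integral of order `m` of `f`. -/
def primitiveChain (m : ℕ) (f : ℝ → ℂ) (j : ℕ) : ℝ → ℂ :=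
  if j < m then cconv (rlKernel ((m : ℂ) - j)) f else f

lemma derivChain_primitiveChain (m : ℕ) {f : ℝ → ℂ} (hf : CausalReg f) :
    DerivChain (primitiveChain m f) m := by
  intro j hj y hy
  rw [primitiveChain, primitiveChain, if_pos hj]
  split_ifs with hj'
  · have h1 : (m : ℂ) - ((j + 1 : ℕ) : ℂ) = m - j - 1 := by push_cast; ring
    have h2 : (j : ℝ) + 1 < m := by exact_mod_cast hj'
    rw [h1]
    refine hasDerivAt_cconv_rlKernel hf ?_ hy
    simp only [Complex.sub_re, Complex.natCast_re, Complex.one_re]; linarith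
  -- The last derivative leaves the kernel of order `1`; order `0` would not be a function, hence
  -- the case split in `primitiveChain`.
  · have h1 : (m : ℂ) - j = 1 := by
      have : m = j + 1 := by omega
      rw [this]; push_cast; ring
    rw [h1]
    exact hasDerivAt_cconv_one hf hy

/-- The condition `βk + μ = q + m` says that the orders from index `k` on exceed those of a series
kernel of order `q` by exactly `m`. -/
lemma cconv_kernelFun_eq {abar : ℕ → ℂ} {μ β : ℂ} (hμ : 0 < μ.re) (hβ : 0 < β.re)
    (hb : GeomBdd (gammaCoeff abar μ β)) {v : ℝ → ℂ} (hv : CausalReg v) (k m : ℕ) {q : ℂ}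
    (hq : 0 < q.re) (hqm : β * k + μ = q + m) (hm : 0 < m) {y : ℝ} (hy : 0 < y) :
    cconv (fun r : ℝ => (r : ℂ) ^ (μ - 1) * kernelFun abar ((r : ℂ) ^ β)) v y =
      (∑ n ∈ Finset.range k, gammaCoeff abar μ β n * cconv (rlKernel (β * n + μ)) v y) +
      cconv (rlKernel (m : ℂ))
        (cconv (seriesKernel (fun n => gammaCoeff abar μ β (n + k)) β q) v) y := by
  have hre : ∀ n : ℕ, 0 < (β * n + μ).re := fun n => by simp; positivity
  have hm' : 0 < ((m : ℕ) : ℂ).re := by simpa using hm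
  have hS := (hb.shift k).causalReg_seriesKernel hβ hq
  have hK : ∀ r : ℝ, 0 < r → (r : ℂ) ^ (μ - 1) * kernelFun abar ((r : ℂ) ^ β) =
      (∑ n ∈ Finset.range k, gammaCoeff abar μ β n * rlKernel (β * n + μ) r) +
      cconv (rlKernel (m : ℂ)) (seriesKernel (fun n => gammaCoeff abar μ β (n + k)) β q) r := by
    intro r hr
    have hr0 : (r : ℂ) ≠ 0 := by exact_mod_cast hr.ne'
    have h1 : (r : ℂ) ^ (μ - 1) * kernelFun abar ((r : ℂ) ^ β) = seriesKernel
        (gammaCoeff abar μ β) β μ r := by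
      rw [kernelFun, seriesKernel, ← tsum_mul_left]
      refine tsum_congr fun n => ?_
      have hG := Complex.Gamma_ne_zero_of_re_pos (hre n)
      rw [gammaCoeff, rlKernel, ← Complex.cpow_mul_nat,
        show β * n + μ - 1 = (μ - 1) + β * n by ring, Complex.cpow_add _ _ hr0]
      field_simp
    rw [h1, (hb.shift k).cconv_rlKernel_seriesKernel hβ hq hm' hr, seriesKernel,
      ← (hb.summable hβ hμ hr).sum_add_tsum_nat_add k, seriesKernel]
    congr 2
    ext n
    rw [← hqm]
    push_cast
    ring_nf
  rw [cconv_congr hK (fun _ _ => rfl) hy, cconv_add_left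
    (CausalReg.sum fun n _ => (causalReg_rlKernel (hre n)).const_mul _)
    ((causalReg_rlKernel hm').cconv hS) hv hy,
    cconv_sum_left (fun n _ => (causalReg_rlKernel (hre n)).const_mul _) hv hy,
    cconv_assoc (causalReg_rlKernel hm') hS hv hy]
  simp only [cconv_const_mul_left]

lemma re_mul_natCast (z : ℂ) (n : ℕ) : (z * n).re = n * z.re := by simp [mul_comm]

lemma lt_floor_add_one_mul_re (α : ℂ) {β : ℂ} (hβ : 0 < β.re) :
    α.re < (⌊α.re / β.re⌋₊ + 1 : ℝ) * β.re := by
  rw [← div_lt_iff₀ hβ]; exact Nat.lt_floor_add_one _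

lemma re_sub_mul_natCast (α β : ℂ) (n : ℕ) : (α - β * n).re = α.re - n * β.re := by
  simp [mul_comm]

lemma initOrder_le {α β : ℂ} (hβ : 0 < β.re) (n : ℕ) : initOrder α β n ≤ ⌊α.re⌋₊ := by
  refine Nat.floor_le_floor ?_
  rw [re_sub_mul_natCast]
  linarith [show 0 ≤ n * β.re by positivity]

lemma exists_derivChain_genIntegral {α β : ℂ} (hβ : 0 < β.re) {M : ℕ}
    (hM : M = ⌊α.re⌋₊) {μ : ℂ} (hμ : μ = ((M + 1 : ℕ) : ℂ) - α) {abar : ℕ → ℂ}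
    (hb : GeomBdd (gammaCoeff abar μ β)) {v : ℝ → ℂ} (hv : CausalReg v) {F : ℕ → ℕ → ℝ → ℂ}
    (hF : ∀ n, DerivChain (F n) (M + 1))
    (hF0 : ∀ n y, 0 < y → F n 0 y = cconv (rlKernel (β * n + μ)) v y)
    (hreg : ∀ n ≤ ⌊α.re / β.re⌋₊, gammaCoeff abar μ β n ≠ 0 → CausalReg (F n (M + 1)))
    {c : ℝ} (hlap : ∀ s : ℂ, c < s.re → LapConv v s ∧
      ∀ n ≤ ⌊α.re / β.re⌋₊, gammaCoeff abar μ β n ≠ 0 → LapConv (F n (M + 1)) s)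
    {l : ℕ → ℕ → ℂ} (hl : ∀ n ≤ ⌊α.re / β.re⌋₊, gammaCoeff abar μ β n ≠ 0 →
      ∀ i ≤ initOrder α β n, Tendsto (F n (M - initOrder α β n + i)) (𝓝[>] 0) (𝓝 (l n i))) :
    ∃ G : ℕ → ℝ → ℂ, DerivChain G (M + 1) ∧
      (∀ y, 0 < y → G 0 y =
        cconv (fun r : ℝ => (r : ℂ) ^ (μ - 1) * kernelFun abar ((r : ℂ) ^ β)) v y) ∧
      ∃ σ : ℝ, ∀ s : ℂ, σ < s.re → LapConv v s ∧ LapConv (G (M + 1)) s ∧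
        (Summable fun n : ℕ => gammaCoeff abar μ β n * s ^ (α - β * n)) ∧
        lap (G (M + 1)) s = (∑' n : ℕ, gammaCoeff abar μ β n * s ^ (α - β * n)) * lap v s -
          ∑ n ∈ Finset.range (⌊α.re / β.re⌋₊ + 1), ∑ i ∈ Finset.range (initOrder α β n + 1),
            gammaCoeff abar μ β n * s ^ (initOrder α β n - i) * l n i := by
  set b := gammaCoeff abar μ β with hbdef
  set n₀ := ⌊α.re / β.re⌋₊ with hn₀
  -- The first index past `Re α / Re β` makes `Re q` positive.
  set q : ℂ := β * ((n₀ + 1 : ℕ) : ℂ) - α with hqdef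
  have hq : 0 < q.re := by
    have := lt_floor_add_one_mul_re α hβ
    rw [hqdef, Complex.sub_re, re_mul_natCast]
    push_cast
    linarith
  have hμre : 0 < μ.re := by
    have := Nat.lt_floor_add_one α.re
    rw [hμ, Complex.sub_re, Complex.natCast_re, hM]; push_cast; linarith
  have hre : ∀ n : ℕ, 0 < (β * n + μ).re := fun n => by simp; positivity
  set S := seriesKernel (fun n => b (n + (n₀ + 1))) β q with hS
  have hb' := hb.shift (n₀ + 1)
  have hSreg : CausalReg S := hb'.causalReg_seriesKernel hβ hq
  have hT : CausalReg (cconv S v) := hSreg.cconv hv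
  refine ⟨fun j y => (∑ n ∈ Finset.range (n₀ + 1), b n * F n j y) +
    primitiveChain (M + 1) (cconv S v) j y, ?_, ?_, ?_⟩
  · intro j hj y hy
    exact (HasDerivAt.fun_sum fun n _ => (hF n j hj y hy).const_mul (b n)).add
      (derivChain_primitiveChain (M + 1) hT j hj y hy)
  · intro y hy
    rw [cconv_kernelFun_eq hμre hβ hb hv (n₀ + 1) (M + 1) hq (by rw [hqdef, hμ]; ring)
      M.succ_pos hy]
    dsimp only
    congr 1
    · exact Finset.sum_congr rfl fun n _ => by rw [hF0 n y hy]
    · rw [primitiveChain, if_pos M.succ_pos, Nat.cast_zero, sub_zero]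
  obtain ⟨L, hL, hLap⟩ := hb'.exists_lapConv_seriesKernel hβ hq
  refine ⟨max c L, fun s hs => ?_⟩
  obtain ⟨hvs, hFs⟩ := hlap s ((le_max_left _ _).trans_lt hs)
  obtain ⟨hSs, hSsum⟩ := hLap s ((le_max_right _ _).trans_lt hs)
  have hs0 : 0 < s.re := (hL.trans_le (le_max_right _ _)).trans hs
  -- Nothing is known about the last derivative of `F n` when `b n = 0`; then the product is zero
  -- anyway.
  have hterm : ∀ n ∈ Finset.range (n₀ + 1), LapConv (fun y => b n * F n (M + 1) y) s := by
    intro n hn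
    by_cases hbn : b n = 0
    · exact ((lapConv_rlKernel (p := 1) (by simp) hs0).const_mul 0).congr
        fun y _ => by simp [hbn]
    · exact (hFs n (Nat.lt_succ_iff.1 (Finset.mem_range.1 hn)) hbn).const_mul _
  have hTs : LapConv (cconv S v) s := hSs.cconv hvs
  have hlast : primitiveChain (M + 1) (cconv S v) (M + 1) = cconv S v := by
    rw [primitiveChain, if_neg (lt_irrefl _)]
  have hexp : ∀ n : ℕ, b (n + (n₀ + 1)) * s ^ (-(β * n + q)) =
      b (n + (n₀ + 1)) * s ^ (α - β * ((n + (n₀ + 1) : ℕ) : ℂ)) := by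
    intro n; rw [hqdef]; push_cast; ring_nf
  simp only [hexp] at hSsum
  have hsum : Summable fun n : ℕ => b n * s ^ (α - β * n) :=
    (summable_nat_add_iff (n₀ + 1)).1 hSsum.summable
  refine ⟨hvs, ?_, hsum, ?_⟩
  · simp only [hlast]
    exact (LapConv.sum hterm).add hTs
  · simp only [hlast]
    rw [lap_add (LapConv.sum hterm) hTs, lap_sum hterm, lap_cconv hSs hvs,
      ← hsum.sum_add_tsum_nat_add (n₀ + 1), hSsum.tsum_eq, add_mul, add_sub_right_comm,
      Finset.sum_mul, ← Finset.sum_sub_distrib]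
    congr 1
    refine Finset.sum_congr rfl fun n hn => ?_
    rw [lap_const_mul]
    by_cases hbn : b n = 0
    · simp [hbn]
    have hn := Nat.lt_succ_iff.1 (Finset.mem_range.1 hn)
    have hN : initOrder α β n ≤ M := hM ▸ initOrder_le hβ n
    have hNlt : α.re - n * β.re < initOrder α β n + 1 := by
      rw [← re_sub_mul_natCast]; exact Nat.lt_floor_add_one _
    have hpre : (β * n + μ).re = n * β.re + (M + 1) - α.re := by
      rw [Complex.add_re, hμ, Complex.sub_re, Complex.natCast_re, re_mul_natCast]
      push_cast; ring
    rw [(hF n).lap_eq_of_cconv (N := initOrder α β n) (hreg n hn hbn) hv (hre n) (hF0 n)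
      (by omega) (by rw [hpre]; push_cast; linarith) hs0 (hFs n hn hbn) hvs
      (fun i hi => by simpa using hl n hn hbn i hi), mul_sub, Finset.mul_sum, hμ]
    congr 1
    · ring_nf
    · exact Finset.sum_congr rfl fun i _ => by ring

end

/-! ### The transform formula -/

theorem mainTheorem11
    (α β : ℂ) (hα : 0 ≤ α.re) (hα0 : α ≠ 0) (hβ : 0 < β.re)
    (m : ℕ) (hm : m = ⌊α.re⌋₊ + 1)
    (φ : ℝ → ℝ) (hφ : ContDiffOn ℝ m φ (Ici 0)) (hφ0 : φ 0 = 0)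
    (hφd : ∀ x : ℝ, 0 < x → 0 < deriv φ x) (hφt : Tendsto φ atTop atTop)
    (a abar : ℕ → ℂ) (ha : HasPosRadius (gammaCoeff a α β))
    (habar : PowerSeries.mk (gammaCoeff a α β) *
      PowerSeries.mk (gammaCoeff abar ((m : ℂ) - α) β) = 1)
    (u : ℝ → ℂ)
    (hu_int : ∀ T : ℝ, 0 < T → IntegrableOn (fun t => ((deriv φ t : ℝ) : ℂ) * u t) (Ioc 0 T))
    (hu_cont : ContinuousOn u (Ioi 0)) (hu_exp : PhiExpOrder φ u)
    (hD_diff : ∀ k < m,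
      DifferentiableOn ℝ ((phiDeriv φ)^[k] (rlIntegral φ ((m : ℂ) - α) u)) (Ioi 0))
    (hD_cont : ∀ k ≤ m,
      ContinuousOn ((phiDeriv φ)^[k] (rlIntegral φ ((m : ℂ) - α) u)) (Ioi 0))
    (hD_exp : ∀ k ≤ m, PhiExpOrder φ ((phiDeriv φ)^[k] (rlIntegral φ ((m : ℂ) - α) u)))
    (hD_pc : PiecewiseContinuousIci (rlDerivative φ α u))
    (h_init : ∀ n : ℕ, 1 ≤ n → n ≤ ⌊α.re / β.re⌋₊ → abar n ≠ 0 →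
      ∀ i ≤ initOrder α β n, HasValueAtZero (initFun φ α β u n i)) :
    (∀ k < m,
      DifferentiableOn ℝ ((phiDeriv φ)^[k] (genIntegral φ abar ((m : ℂ) - α) β u)) (Ioi 0)) ∧
    (∃ σ : ℝ, ∀ s : ℂ, σ < s.re →
      PhiLaplaceConvergent φ u s ∧
      PhiLaplaceConvergent φ (genDerivative φ abar α β u) s ∧
      Summable fun n : ℕ => abar n * Complex.Gamma (β * n - α + m) * s ^ (α - β * n)) ∧
    ∀ s : ℂ, 0 < s.re →
      PhiLaplaceConvergent φ u s →
      PhiLaplaceConvergent φ (genDerivative φ abar α β u) s →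
      (Summable fun n : ℕ => abar n * Complex.Gamma (β * n - α + m) * s ^ (α - β * n)) →
      phiLaplace φ (genDerivative φ abar α β u) s =
        (∑' n : ℕ, abar n * Complex.Gamma (β * n - α + m) * s ^ (α - β * n) * phiLaplace φ u s) -
        ∑ n ∈ Finset.range (⌊α.re / β.re⌋₊ + 1), ∑ i ∈ Finset.range (initOrder α β n + 1),
          abar n * Complex.Gamma (β * n - α + m) * s ^ (initOrder α β n - i) *
            valueAtZero (initFun φ α β u n i) := by
  have h : PhiMap φ := ⟨hφ.continuousOn, hφ0, hφd, hφt⟩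
  set v := u ∘ phiInv φ with hvdef
  have hv : CausalReg v := h.causalReg_comp_inv hu_cont hu_int
  obtain ⟨M, hM⟩ : ∃ M, M = ⌊α.re⌋₊ := ⟨_, rfl⟩
  rw [← hM] at hm
  subst hm
  set μ : ℂ := ((M + 1 : ℕ) : ℂ) - α with hμ
  have hμre : 0 < μ.re := by
    have := Nat.lt_floor_add_one α.re
    rw [hμ, Complex.sub_re, Complex.natCast_re, hM]; push_cast; linarith
  have hre : ∀ n : ℕ, 0 < (β * n + μ).re := fun n => by simp; positivity
  have hb : GeomBdd (gammaCoeff abar μ β) := ha.exists_geometric_bound.of_mul_eq_one habar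
  set W : ℕ → ℝ → ℂ := fun j => (phiDeriv φ)^[j] (rlIntegral φ μ u) ∘ phiInv φ with hW
  have hWc : DerivChain W (M + 1) := h.derivChain_comp_inv hD_diff
  have hW0 : ∀ y, 0 < y → W 0 y = cconv (rlKernel μ) v y := by
    intro y hy
    change rlIntegral φ μ u (phiInv φ y) = _
    rw [h.rlIntegral_eq _ _ (h.inv_pos hy), h.apply_inv hy]
  -- The finite limit of `D^α u` at `0⁺` makes it integrable there, so `I^μ u` has Taylor
  -- coefficients `w`.
  have hWreg : CausalReg (W (M + 1)) := by
    obtain ⟨L, hL⟩ := (hD_pc.2 0 le_rfl).1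
    refine causalReg_of_tendsto (l := L) (h.continuousOn_comp_inv (hD_cont _ le_rfl)) ?_
    refine h.tendsto_comp_iff.2 ?_
    rwa [rlDerivative, ← hM] at hL
  obtain ⟨w, hw⟩ := hWc.exists_tendsto hWreg
  -- `F n 0` is the fractional integral of order `βn + μ`. For `n ≥ 1` it is the one of order `βn`
  -- of `W 0`, in Taylor form; `n = 0` has no such smoothing and uses the assumed derivatives
  -- directly.
  set F : ℕ → ℕ → ℝ → ℂ := fun n => if n = 0 then W else
    fracChain w (M + 1) (β * n) (W (M + 1)) with hFdef
  have hβn : ∀ n : ℕ, n ≠ 0 → 0 < (β * n).re := fun n hn => by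
    rw [re_mul_natCast]
    exact mul_pos (by exact_mod_cast Nat.pos_of_ne_zero hn) hβ
  have hF : ∀ n, DerivChain (F n) (M + 1) := by
    intro n
    by_cases hn : n = 0
    · simp only [hFdef, if_pos hn]; exact hWc
    · simp only [hFdef, if_neg hn]
      exact derivChain_fracChain w (M + 1) (hβn n hn) hWreg
  have hF0 : ∀ n y, 0 < y → F n 0 y = cconv (rlKernel (β * n + μ)) v y := by
    intro n y hy
    by_cases hn : n = 0
    · simp only [hFdef, if_pos hn]
      rw [hW0 y hy, hn]; simp
    · simp only [hFdef, if_neg hn]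
      rw [← hWc.cconv_eq_fracChain hWreg hw (hβn n hn) hy,
        cconv_congr (fun _ _ => rfl) hW0 hy, cconv_rlKernel_cconv hv (hβn n hn) hμre hy]
  have hinit : ∀ n i : ℕ, i ≤ initOrder α β n → ∀ x, 0 < x →
      initFun φ α β u n i x = F n (M - initOrder α β n + i) (φ x) := by
    intro n i hi x hx
    have hN : initOrder α β n ≤ M := hM ▸ initOrder_le hβ n
    rw [← h.rlDifferintegral_eq hv (hF n) (hre n) (hF0 n) (by omega) hx, initFun]
    congr 1
    rw [hμ]; push_cast [Nat.cast_sub hN]; ring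
  have hlim : ∀ n i : ℕ, i ≤ initOrder α β n → ∀ L : ℂ,
      Tendsto (initFun φ α β u n i) (𝓝[>] 0) (𝓝 L) ↔
        Tendsto (F n (M - initOrder α β n + i)) (𝓝[>] 0) (𝓝 L) := by
    intro n i hi L
    rw [← h.tendsto_comp_iff]
    refine tendsto_congr' ?_
    filter_upwards [self_mem_nhdsWithin] with y hy
    simp only [Function.comp_apply]
    rw [hinit n i hi _ (h.inv_pos hy), h.apply_inv hy]
  have habar0 : ∀ n, gammaCoeff abar μ β n ≠ 0 → abar n ≠ 0 := fun n => left_ne_zero_of_mul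
  -- The initial value with `i = Nₙ` is the limit of the derivative of order `M = m - 1`, as
  -- `fracChain_last` requires.
  have hlast : ∀ n ≤ ⌊α.re / β.re⌋₊, gammaCoeff abar μ β n ≠ 0 → n ≠ 0 →
      CausalReg (F n (M + 1)) ∧
        ∀ s : ℂ, 0 < s.re → LapConv (W (M + 1)) s → LapConv (F n (M + 1)) s := by
    intro n hn hbn hn0
    obtain ⟨L, hL⟩ := h_init n (Nat.one_le_iff_ne_zero.2 hn0) hn (habar0 n hbn) _ le_rfl
    rw [hlim n _ le_rfl, Nat.sub_add_cancel (hM ▸ initOrder_le hβ n)] at hL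
    simp only [hFdef, if_neg hn0] at hL ⊢
    exact fracChain_last (hβn n hn0) hWreg hL
  have hreg : ∀ n ≤ ⌊α.re / β.re⌋₊, gammaCoeff abar μ β n ≠ 0 → CausalReg (F n (M + 1)) := by
    intro n hn hbn
    by_cases hn0 : n = 0
    · simp only [hFdef, if_pos hn0]; exact hWreg
    · exact (hlast n hn hbn hn0).1
  obtain ⟨c₁, hc₁⟩ := h.exists_lapConv hv hu_exp
  obtain ⟨c₂, hc₂⟩ := h.exists_lapConv hWreg (hD_exp _ le_rfl)
  have hl : ∀ n ≤ ⌊α.re / β.re⌋₊, gammaCoeff abar μ β n ≠ 0 → ∀ i ≤ initOrder α β n,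
      Tendsto (F n (M - initOrder α β n + i)) (𝓝[>] 0)
        (𝓝 (valueAtZero (initFun φ α β u n i))) := by
    intro n hn hbn i hi
    have hN : initOrder α β n ≤ M := hM ▸ initOrder_le hβ n
    obtain ⟨l, hl⟩ := (hF n).exists_tendsto (hreg n hn hbn)
    rw [← hlim n i hi]
    -- `valueAtZero` is meaningful only once a limit exists; the regular last derivative supplies
    -- one.
    exact tendsto_nhds_limUnder ⟨_, (hlim n i hi _).2 (hl _ (by omega))⟩
  obtain ⟨G, hG, hG0, σ, hσ⟩ := exists_derivChain_genIntegral hβ hM hμ hb hv hF hF0 hreg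
    (c := max 0 (max c₁ c₂)) (fun s hs => by
      simp only [max_lt_iff] at hs
      refine ⟨hc₁ s hs.2.1, fun n hn hbn => ?_⟩
      by_cases hn0 : n = 0
      · simp only [hFdef, if_pos hn0]; exact hc₂ s hs.2.2
      · exact (hlast n hn hbn hn0).2 s hs.1 (hc₂ s hs.2.2)) hl
  have hgen0 : ∀ x, 0 < x → genIntegral φ abar μ β u x = G 0 (φ x) := by
    intro x hx
    rw [h.genIntegral_eq _ _ _ _ hx, hG0 _ (h.pos hx)]
  have hgen : ∀ y, 0 < y → (genDerivative φ abar α β u ∘ phiInv φ) y = G (M + 1) y := by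
    intro y hy
    rw [Function.comp_apply, genDerivative, ← hM,
      h.phiDeriv_iterate_eq hG hgen0 (M + 1) le_rfl _ (h.inv_pos hy), h.apply_inv hy]
  have hcoeff : ∀ n : ℕ, abar n * Complex.Gamma (β * n - α + ((M + 1 : ℕ) : ℂ)) =
      gammaCoeff abar μ β n := by
    intro n
    rw [gammaCoeff, hμ, sub_add_eq_add_sub, add_sub_assoc]
  simp only [hcoeff, h.lapConv_iff, h.phiLaplace_eq]
  refine ⟨fun k hk => h.differentiableOn_phiDeriv_iterate hG hgen0 hk, ⟨σ, fun s hs => ?_⟩, ?_⟩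
  · obtain ⟨h1, h2, h3, -⟩ := hσ s hs
    exact ⟨h1, h2.congr hgen, h3⟩
  · intro s hs hus hgs hsum
    rw [tsum_mul_right]
    refine lap_eq_of_eventually hs hβ hgs hus hsum (σ := σ)
      (Z := fun s => ∑ n ∈ Finset.range (⌊α.re / β.re⌋₊ + 1),
        ∑ i ∈ Finset.range (initOrder α β n + 1), gammaCoeff abar μ β n *
          s ^ (initOrder α β n - i) * valueAtZero (initFun φ α β u n i)) (by fun_prop)
      fun s hs => ?_
    rw [lap_congr hgen]
    exact (hσ s hs).2.2.2
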